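/- **Setting.** Let $n\ge 3$ and let ${\bf a}=(a_1,\dots,a_n)$ be a sequence of points of $\mathbb C^2$ with coordinates $(x,y)$; put $z=x+iy$ and $\bar z=x-iy$, which are two independent complex linear coordinates on $\mathbb C^2$. Let $\Gamma_{\bf a}$ be the oriented closed polygonal curve $[a_1,a_2]\cup\dots\cup[a_{n-1},a_n]\cup[a_n,a_1]$. Let $P_*\subset\mathbb R^2$ be an auxiliary convex polygon with vertices $w_1,\dots,w_n$ ordered counterclockwise and let $\mathcal T$ be a triangulation of $P_*$, i.e. a set of diagonals of $P_*$ that have no common internal points and cut $P_*$ into triangles. Let $F=F_{{\bf a},\mathcal T}:P_*\to\mathbb C^2$ be the unique map that sends each $w_j$ to $a_j$ and is affine on every triangle of $\mathcal T$. The polygonal measure $\mu_{{\bf a},\mathcal T}$ is the complex Borel measure on $\mathbb C^2$ that is the direct image under $F$ of the complex measure $F^*(dx\wedge dy)$ on $P_*$; that is, $\mu_{{\bf a},\mathcal T}(B)=\int_{P_*\cap F^{-1}(B)}J_F$, where $J_F$ is the ($\mathbb C$-valued, piecewise constant) Jacobian determinant of $(x\circ F,y\circ F)$ and the integral is with respect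 to Lebesgue measure. **Theorem.** (i) Let $h:\mathbb C^2\to\mathbb C$ be holomorphic. Then $h$ is integrable with respect to $\mu_{{\bf a},\mathcal T}$, and the integral $\int h\,d\mu_{{\bf a},\mathcal T}$ does not depend on the triangulation $\mathcal T$ (nor on $P_*$). It is equal to $\int_{\Gamma_{\bf a}}\omega$ for every complex-valued 1-form $\omega$ of class $C^1$ on $\mathbb C^2$ such that $d\omega=\frac i2\,h\,dz\wedge d\bar z$ (equivalently $d\omega = h\,dx\wedge dy$). (ii) If all the vertices $a_1,\dots,a_n$ are real, i.e. lie in $\mathbb R^2\subset\mathbb C^2$, then $\mu_{{\bf a},\mathcal T}$ does not depend on $\mathcal T$ (nor on $P_*$). It is supported on a compact subset of $\mathbb R^2$ and is absolutely continuous with respect to the Lebesgue measure of $\mathbb R^2$; its density at a point $q\in\mathbb R^2\setminus\Gamma_{\bf a}$ is the winding number of $\Gamma_{\bf a}$ around $q$ (the linking number of the 1-cycle $\Gamma_{\bf a}$ with the 0-cycle $q-\infty$), and every such $q$ has a neighbourhood on which $\mu_{{\bf a},\mathcal T}$ equals this number times the Lebesgue measure. In particular, if $a_1,\dots,a_n$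 are the vertices, listed counterclockwise, of a simply connected polygon $P\subset\mathbb R^2$ (a compact set whose boundary is the curve $\Gamma_{\bf a}$, which has no self-intersections, and which lies to the left of each side), then $\mu_{{\bf a},\mathcal T}$ is the Lebesgue measure of $P$. -/

import Mathlib

open MeasureTheory Set Topology

namespace PolygonalMeasure

/-! The Euclidean plane is identified with `ℂ` by `(x, y) ↔ x + i y`; the complexified plane
`ℂ²` is `ℂ × ℂ` with coordinates `(x, y)`. Vertices of an `n`-gon are indexed cyclically by
`Fin n`; the successor of `j` is `finRotate n j`. -/

/-! ### Convex polygons and their triangulations -/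

/-- The determinant `det (u, v)` of two vectors of the plane. -/
def cross (u v : ℂ) : ℝ := u.re * v.im - u.im * v.re

/-- The points `w 0, …, w (n - 1)` are the vertices of a convex polygon, listed
counterclockwise: every triple of vertices in increasing order is positively oriented. -/
def IsConvexCCW {n : ℕ} (w : Fin n → ℂ) : Prop :=
  ∀ i j k : Fin n, i < j → j < k → 0 < cross (w j - w i) (w k - w i)

/-- The (filled) convex polygon with the given vertices. -/
def convexPolygon {n : ℕ} (w : Fin n → ℂ) : Set ℂ := convexHull ℝ (range w)

/-- The pair `{i, j}` indexes a side of the `n`-gon. -/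
def IsSide {n : ℕ} (i j : Fin n) : Prop := j = finRotate n i ∨ i = finRotate n j

/-- `i < j < k` and each of the three pairs is a side of the polygon or belongs to `D`. For a set
`D` of diagonals of a convex polygon without common internal points, these are the triangles into
which `D` cuts the polygon. -/
def IsFace {n : ℕ} (D : Set (Sym2 (Fin n))) (i j k : Fin n) : Prop :=
  i < j ∧ j < k ∧ (IsSide i j ∨ s(i, j) ∈ D) ∧ (IsSide j k ∨ s(j, k) ∈ D) ∧
    (IsSide i k ∨ s(i, k) ∈ D)

/-- A triangulation of the convex polygon with vertices `w`: a set `D` of diagonals without common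
internal points that cuts the polygon into triangles. -/
structure IsTriangulation {n : ℕ} (w : Fin n → ℂ) (D : Set (Sym2 (Fin n))) : Prop where
  diagonal : ∀ i j : Fin n, s(i, j) ∈ D → i ≠ j ∧ ¬ IsSide i j
  noncrossing : ∀ i j k l : Fin n, s(i, j) ∈ D → s(k, l) ∈ D → s(i, j) ≠ s(k, l) →
    Disjoint (openSegment ℝ (w i) (w j)) (openSegment ℝ (w k) (w l))
  cover : ∀ p ∈ convexPolygon w, ∃ i j k : Fin n, IsFace D i j k ∧
    p ∈ convexHull ℝ {w i, w j, w k}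

/-! ### The piecewise affine map -/

/-- `F` maps `w j` to `a j` and is affine on every triangle of the triangulation `D`. Only the
values of `F` on the polygon matter; elsewhere `F` is set to zero. -/
structure IsPLMap {n : ℕ} (w : Fin n → ℂ) (D : Set (Sym2 (Fin n))) (a : Fin n → ℂ × ℂ)
    (F : ℂ → ℂ × ℂ) : Prop where
  affine : ∀ i j k : Fin n, IsFace D i j k → ∀ α β γ : ℝ, 0 ≤ α → 0 ≤ β → 0 ≤ γ →
    α + β + γ = 1 →
    F (α • w i + β • w j + γ • w k) = α • a i + β • a j + γ • a k
  zero_off : ∀ p, p ∉ convexPolygon w → F p = 0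

/-- The map `F_{a,D}` from the polygon to `ℂ²`. Its existence and uniqueness are proved in
`existsUnique_isPLMap` and `plMap_spec` below. -/
noncomputable def plMap {n : ℕ} (w : Fin n → ℂ) (D : Set (Sym2 (Fin n))) (a : Fin n → ℂ × ℂ) :
    ℂ → ℂ × ℂ :=
  Classical.epsilon (IsPLMap w D a)

section Existence

variable {n : ℕ} {w : Fin n → ℂ} {D : Set (Sym2 (Fin n))}

theorem IsSide.symm {i j : Fin n} (h : IsSide i j) : IsSide j i := Or.symm h

theorem not_between_of_isSide {p q x y : Fin n} (hs : IsSide p q) (hpx : p < x) (hxq : x < q)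
    (hy : y < p ∨ q < y) : False := by
  obtain _ | m := n
  · exact p.elim0
  · rcases hs with h | h <;> rw [finRotate_apply] at h
    · have := Fin.val_add_one p
      rw [← h] at this
      simp only [Fin.ext_iff, Fin.val_last] at this
      split_ifs at this <;> omega
    · have := Fin.val_add_one q
      rw [← h] at this
      simp only [Fin.ext_iff, Fin.val_last] at this
      split_ifs at this <;> omega

theorem exists_mem_openSegments (hw : IsConvexCCW w) {i j k l : Fin n} (hij : i < j) (hjk : j < k)
    (hkl : k < l) :
    ∃ z, z ∈ openSegment ℝ (w i) (w k) ∧ z ∈ openSegment ℝ (w j) (w l) := by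
  have h1 := hw i j k hij hjk
  have h2 := hw i j l hij (hjk.trans hkl)
  have h3 := hw i k l (hij.trans hjk) hkl
  have h4 := hw j k l hjk hkl
  set α := cross (w k - w j) (w l - w j) with hα
  set β := cross (w k - w i) (w l - w i) with hβ
  set γ := cross (w j - w i) (w l - w i) with hγ
  set δ := cross (w j - w i) (w k - w i) with hδ
  have hsum : α + γ = β + δ := by
    simp only [hα, hβ, hγ, hδ, cross, Complex.sub_re, Complex.sub_im]; ring
  have hpos : 0 < α + γ := by positivity
  refine ⟨(α / (α + γ)) • w i + (γ / (α + γ)) • w k,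
    ⟨_, _, by positivity, by positivity, by field_simp, rfl⟩,
    ⟨β / (α + γ), δ / (α + γ), by positivity, by positivity, by rw [← add_div, ← hsum, div_self hpos.ne'], ?_⟩⟩
  have key : β • w j + δ • w l = α • w i + γ • w k := by
    apply Complex.ext <;>
    · simp only [hα, hβ, hγ, hδ, cross, Complex.sub_re, Complex.sub_im, Complex.add_re,
        Complex.add_im, Complex.real_smul, Complex.re_ofReal_mul, Complex.im_ofReal_mul]
      ring
  have := congrArg (fun z => (α + γ)⁻¹ • z) key
  simpa only [smul_add, smul_smul, div_eq_inv_mul] using this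

/-- Two edges (sides or members of `D`) do not cross. -/
theorem edge_between (hw : IsConvexCCW w) (hD : IsTriangulation w D) {p q x y : Fin n}
    (hpq : IsSide p q ∨ s(p, q) ∈ D) (hxy : IsSide x y ∨ s(x, y) ∈ D)
    (hpx : p < x) (hxq : x < q) (hy : y < p ∨ q < y) : False := by
  rcases hpq with h | h
  · exact not_between_of_isSide h hpx hxq hy
  rcases hxy with h' | h'
  · rcases hy with hy | hy
    · exact not_between_of_isSide h'.symm hy hpx (Or.inr hxq)
    · exact not_between_of_isSide h' hxq hy (Or.inl hpx)
  have hne : s(p, q) ≠ s(x, y) := by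
    intro he
    rw [Sym2.eq_iff] at he
    rcases he with ⟨h1, -⟩ | ⟨-, h1⟩
    · exact hpx.ne h1
    · exact hxq.ne' h1
  have hdis := hD.noncrossing p q x y h h' hne
  rcases hy with hy | hy
  · obtain ⟨z, h1, h2⟩ := exists_mem_openSegments hw hy hpx hxq
    rw [openSegment_symm] at h1
    exact Set.disjoint_left.1 hdis h2 h1
  · obtain ⟨z, h1, h2⟩ := exists_mem_openSegments hw hpx hxq hy
    exact Set.disjoint_left.1 hdis h1 h2

/-- The weighted sum of the values of an affine function vanishing on a chord. -/
theorem sum_mul_cross (c : Fin n → ℝ) (hc : ∑ l, c l = 1) (u z : ℂ) :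
    ∑ l, c l * cross u (w l - z) = cross u (∑ l, c l • w l - z) := by
  have : cross u (∑ l, c l • w l - z) = u.re * (∑ l, c l * (w l).im - (∑ l, c l) * z.im) -
      u.im * (∑ l, c l * (w l).re - (∑ l, c l) * z.re) := by
    simp [cross, hc]
  rw [this]
  simp only [cross, Complex.sub_re, Complex.sub_im, Finset.sum_mul, ← Finset.sum_sub_distrib,
    Finset.mul_sum]
  exact Finset.sum_congr rfl fun l _ => by ring

theorem cross_neg_of_between (hw : IsConvexCCW w) {p q l : Fin n} (h1 : p < l) (h2 : l < q) :
    cross (w q - w p) (w l - w p) < 0 := by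
  have := hw p l q h1 h2
  simp only [cross] at *
  linarith

theorem cross_pos_of_outside (hw : IsConvexCCW w) {p q l : Fin n} (hpq : p < q)
    (h : l < p ∨ q < l) : 0 < cross (w q - w p) (w l - w p) := by
  rcases h with h | h
  · have := hw l p q h hpq
    simp only [cross, Complex.sub_re, Complex.sub_im] at *
    linarith
  · exact hw p q l hpq h

theorem eq_of_separated (hw : IsConvexCCW w) {p q : Fin n} (hpq : p < q) {c d : Fin n → ℝ}
    (hc0 : ∀ l, 0 ≤ c l) (hd0 : ∀ l, 0 ≤ d l) (hc1 : ∑ l, c l = 1) (hd1 : ∑ l, d l = 1)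
    (hcd : ∑ l, c l • w l = ∑ l, d l • w l)
    (hc : ∀ l, p < l → l < q → c l = 0) (hd : ∀ l, l < p ∨ q < l → d l = 0)
    (hne : w p ≠ w q) : c = d := by
  have e1 := sum_mul_cross (w := w) c hc1 (w q - w p) (w p)
  have e2 := sum_mul_cross (w := w) d hd1 (w q - w p) (w p)
  have tri : ∀ l : Fin n, l = p ∨ l = q ∨ (p < l ∧ l < q) ∨ (l < p ∨ q < l) := by
    intro l; simp only [Fin.lt_def, Fin.ext_iff]; omega
  have zp : cross (w q - w p) (w p - w p) = 0 := by simp [cross]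
  have zq : cross (w q - w p) (w q - w p) = 0 := by simp only [cross]; ring
  have s1 : ∀ l ∈ Finset.univ, 0 ≤ c l * cross (w q - w p) (w l - w p) := by
    intro l _
    rcases tri l with rfl | rfl | h | h
    · rw [zp, mul_zero]
    · rw [zq, mul_zero]
    · rw [hc l h.1 h.2, zero_mul]
    · exact mul_nonneg (hc0 l) (cross_pos_of_outside hw hpq h).le
  have s2 : ∀ l ∈ Finset.univ, d l * cross (w q - w p) (w l - w p) ≤ 0 := by
    intro l _
    rcases tri l with rfl | rfl | h | h
    · rw [zp, mul_zero]
    · rw [zq, mul_zero]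
    · exact mul_nonpos_of_nonneg_of_nonpos (hd0 l) (cross_neg_of_between hw h.1 h.2).le
    · rw [hd l h, zero_mul]
  have t1 := Finset.sum_nonneg s1
  have t2 := Finset.sum_nonpos s2
  rw [e1, hcd] at t1
  rw [e2] at t2
  have z0 := le_antisymm t2 t1
  rw [← hcd, ← e1, Finset.sum_eq_zero_iff_of_nonneg s1] at z0
  have z0' := le_antisymm t2 t1
  rw [← e2, Finset.sum_eq_zero_iff_of_nonpos s2] at z0'
  have cz : ∀ l, l ≠ p → l ≠ q → c l = 0 := by
    intro l h1 h2
    rcases tri l with h | h | h | h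
    · exact absurd h h1
    · exact absurd h h2
    · exact hc l h.1 h.2
    · exact (mul_eq_zero.1 (z0 l (Finset.mem_univ l))).resolve_right
        (cross_pos_of_outside hw hpq h).ne'
  have dz : ∀ l, l ≠ p → l ≠ q → d l = 0 := by
    intro l h1 h2
    rcases tri l with h | h | h | h
    · exact absurd h h1
    · exact absurd h h2
    · exact (mul_eq_zero.1 (z0' l (Finset.mem_univ l))).resolve_right
        (cross_neg_of_between hw h.1 h.2).ne
    · exact hd l h
  have two : ∀ {M : Type} [AddCommMonoid M] (f : Fin n → M), (∀ l, l ≠ p → l ≠ q → f l = 0) →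
      ∑ l, f l = f p + f q := by
    intro M _ f hf
    rw [← Finset.sum_pair hpq.ne]
    refine (Finset.sum_subset (Finset.subset_univ _) fun l _ hl => ?_).symm
    simp only [Finset.mem_insert, Finset.mem_singleton, not_or] at hl
    exact hf l hl.1 hl.2
  rw [two c cz] at hc1
  rw [two d dz] at hd1
  rw [two _ fun l h1 h2 => by rw [cz l h1 h2, zero_smul],
    two _ fun l h1 h2 => by rw [dz l h1 h2, zero_smul]] at hcd
  have hp : c p = d p := by
    have hcq : c q = 1 - c p := by linarith
    have hdq : d q = 1 - d p := by linarith
    rw [hcq, hdq] at hcd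
    have : (c p - d p) • (w p - w q) = 0 := by
      have h0 := sub_eq_zero.2 hcd
      rw [← h0]
      module
    rcases smul_eq_zero.1 this with h | h
    · linarith
    · exact absurd (sub_eq_zero.1 h) hne
  funext l
  rcases tri l with rfl | rfl | h | h
  · exact hp
  · linarith
  · rw [cz l h.1.ne' h.2.ne, dz l h.1.ne' h.2.ne]
  · have h1 : l ≠ p := by rintro rfl; rcases h with h | h; exacts [h.false, (hpq.trans h).false]
    have h2 : l ≠ q := by rintro rfl; rcases h with h | h; exacts [(hpq.trans h).false, h.false]
    rw [cz l h1 h2, dz l h1 h2]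

theorem eq_of_same_face (hw : IsConvexCCW w) {i j k : Fin n} (hij : i < j) (hjk : j < k)
    {c d : Fin n → ℝ} (hc1 : ∑ l, c l = 1) (hd1 : ∑ l, d l = 1)
    (hcd : ∑ l, c l • w l = ∑ l, d l • w l)
    (hc : ∀ l, l ≠ i → l ≠ j → l ≠ k → c l = 0)
    (hd : ∀ l, l ≠ i → l ≠ j → l ≠ k → d l = 0) : c = d := by
  have hik := hij.trans hjk
  have key : ∀ u z, ∑ l, (c l - d l) * cross u (w l - z) = 0 := by
    intro u z
    simp only [sub_mul, Finset.sum_sub_distrib]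
    rw [sum_mul_cross c hc1, sum_mul_cross d hd1, hcd, sub_self]
  have three : ∀ g : Fin n → ℝ, ∑ l, (c l - d l) * g l =
      (c i - d i) * g i + (c j - d j) * g j + (c k - d k) * g k := by
    intro g
    rw [← Finset.sum_subset (Finset.subset_univ {i, j, k})]
    · rw [Finset.sum_insert (by simp [hij.ne, hik.ne]), Finset.sum_pair hjk.ne, add_assoc]
    · intro l _ hl
      simp only [Finset.mem_insert, Finset.mem_singleton, not_or] at hl
      rw [hc l hl.1 hl.2.1 hl.2.2, hd l hl.1 hl.2.1 hl.2.2, sub_self, zero_mul]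
  have z1 : ∀ u : ℂ, cross u (0 : ℂ) = 0 := by intro u; simp [cross]
  have z2 : ∀ u : ℂ, cross u u = 0 := by intro u; simp only [cross]; ring
  have ek := key (w j - w i) (w i)
  rw [three, sub_self, z1, z2] at ek
  have ek' : c k - d k = 0 := by
    have := hw i j k hij hjk
    simp only [mul_zero, zero_add] at ek
    exact (mul_eq_zero.1 ek).resolve_right this.ne'
  have ei := key (w k - w j) (w j)
  rw [three, sub_self, z1, z2] at ei
  have ei' : c i - d i = 0 := by
    have := cross_pos_of_outside hw hjk (Or.inl hij)
    simp only [mul_zero, add_zero] at ei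
    exact (mul_eq_zero.1 ei).resolve_right this.ne'
  have es := three (fun _ => 1)
  simp only [mul_one, Finset.sum_sub_distrib, hc1, hd1] at es
  funext l
  by_cases h1 : l = i
  · subst h1; linarith
  by_cases h2 : l = j
  · subst h2; linarith
  by_cases h3 : l = k
  · subst h3; linarith
  rw [hc l h1 h2 h3, hd l h1 h2 h3]

theorem vertex_ne (hw : IsConvexCCW w) {i j k : Fin n} (hij : i < j) (hjk : j < k) :
    w i ≠ w j ∧ w j ≠ w k ∧ w i ≠ w k := by
  have h := hw i j k hij hjk
  refine ⟨fun e => ?_, fun e => ?_, fun e => ?_⟩ <;> rw [e] at h <;>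
    simp only [cross, Complex.sub_re, Complex.sub_im] at h <;> linarith

/-- `c` is the system of barycentric coordinates of `p` in one of the triangles. -/
def IsBary (w : Fin n → ℂ) (D : Set (Sym2 (Fin n))) (p : ℂ) (c : Fin n → ℝ) : Prop :=
  (∀ l, 0 ≤ c l) ∧ ∑ l, c l = 1 ∧ ∑ l, c l • w l = p ∧
    ∃ i j k : Fin n, IsFace D i j k ∧ ∀ l, l ≠ i → l ≠ j → l ≠ k → c l = 0

/-- The triangles of a triangulation meet along common vertices and common sides only. -/
theorem IsBary.unique (hw : IsConvexCCW w) (hD : IsTriangulation w D) {p : ℂ} {c d : Fin n → ℝ}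
    (hc : IsBary w D p c) (hd : IsBary w D p d) : c = d := by
  obtain ⟨c0, c1, cp, i, j, k, ⟨hij, hjk, eij, ejk, eik⟩, cs⟩ := hc
  obtain ⟨d0, d1, dp, i', j', k', ⟨hij', hjk', eij', ejk', eik'⟩, ds⟩ := hd
  have hcd := cp.trans dp.symm
  have symm_edge : ∀ {x y : Fin n}, (IsSide x y ∨ s(x, y) ∈ D) → (IsSide y x ∨ s(y, x) ∈ D) := by
    rintro x y (h | h)
    · exact Or.inl h.symm
    · exact Or.inr (Sym2.eq_swap ▸ h)
  obtain ⟨n1, n2, n3⟩ := vertex_ne hw hij hjk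
  by_cases hsame : ∀ v, v = i' ∨ v = j' ∨ v = k' → v = i ∨ v = j ∨ v = k
  · refine eq_of_same_face hw hij hjk c1 d1 hcd cs fun l h1 h2 h3 => ds l ?_ ?_ ?_ <;>
    · intro h
      have := hsame l (by simp [h])
      tauto
  push Not at hsame
  obtain ⟨v, hv, hvi, hvj, hvk⟩ := hsame
  have conn : ∀ x, x = i' ∨ x = j' ∨ x = k' → x = v ∨ (IsSide v x ∨ s(v, x) ∈ D) := by
    rintro x (rfl | rfl | rfl) <;> rcases hv with rfl | rfl | rfl <;>
      first
      | exact Or.inl rfl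
      | exact Or.inr (by assumption)
      | exact Or.inr (symm_edge (by assumption))
  have dz : ∀ l, ¬ (l = i' ∨ l = j' ∨ l = k') → d l = 0 := fun l h => by
    push Not at h; exact ds l h.1 h.2.1 h.2.2
  have hpos : (i < v ∧ v < j) ∨ (j < v ∧ v < k) ∨ (v < i ∨ k < v) := by
    simp only [Fin.lt_def, Fin.ext_iff] at *; omega
  rcases hpos with h | h | h
  · refine eq_of_separated hw hij c0 d0 c1 d1 hcd
      (fun l h1 h2 => cs l h1.ne' h2.ne (h2.trans hjk).ne) (fun l hl => dz l fun hm => ?_) n1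
    rcases conn l hm with rfl | e
    · rcases hl with hl | hl
      exacts [(hl.trans h.1).false, (hl.trans h.2).false]
    · exact edge_between hw hD eij e h.1 h.2 hl
  · refine eq_of_separated hw hjk c0 d0 c1 d1 hcd
      (fun l h1 h2 => cs l (hij.trans h1).ne' h1.ne' h2.ne) (fun l hl => dz l fun hm => ?_) n2
    rcases conn l hm with rfl | e
    · rcases hl with hl | hl
      exacts [(hl.trans h.1).false, (hl.trans h.2).false]
    · exact edge_between hw hD ejk e h.1 h.2 hl
  · refine (eq_of_separated hw (hij.trans hjk) d0 c0 d1 c1 hcd.symm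
      (fun l h1 h2 => dz l fun hm => ?_) (fun l hl => cs l ?_ ?_ ?_) n3).symm
    · rcases conn l hm with rfl | e
      · rcases h with h | h
        exacts [(h.trans h1).false, (h.trans h2).false]
      · exact edge_between hw hD eik (symm_edge e) h1 h2 h
    all_goals
      rintro rfl
      simp only [Fin.lt_def] at *
      omega

theorem isBary_single {i j k : Fin n} (hf : IsFace D i j k) {α β γ : ℝ} (hα : 0 ≤ α) (hβ : 0 ≤ β)
    (hγ : 0 ≤ γ) (h1 : α + β + γ = 1) :
    IsBary w D (α • w i + β • w j + γ • w k) (Pi.single i α + Pi.single j β + Pi.single k γ) := by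
  refine ⟨fun l => ?_, ?_, ?_, i, j, k, hf, fun l hi hj hk => ?_⟩
  · have key : ∀ (m : Fin n) (x : ℝ), 0 ≤ x → 0 ≤ (Pi.single m x : Fin n → ℝ) l := by
      intro m x hx
      rw [Pi.single_apply]
      split_ifs <;> simp [hx]
    exact add_nonneg (add_nonneg (key i α hα) (key j β hβ)) (key k γ hγ)
  · simpa [Finset.sum_add_distrib] using h1
  · simp [add_smul, Finset.sum_add_distrib, Pi.single_apply, ite_smul]
  · simp [hi, hj, hk]

theorem convexHull_triple_subset {i j k : Fin n} :
    convexHull ℝ {w i, w j, w k} ⊆ convexPolygon w := by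
  refine convexHull_mono ?_
  rintro z (rfl | rfl | rfl) <;> exact mem_range_self _

/-- The map that sends `w j` to `a j` and is affine on the triangles exists and is unique. -/
theorem existsUnique_isPLMap (hw : IsConvexCCW w) (hD : IsTriangulation w D)
    (a : Fin n → ℂ × ℂ) : ∃! F, IsPLMap w D a F := by
  classical
  have comb : ∀ {i j k : Fin n} {p : ℂ}, p ∈ convexHull ℝ {w i, w j, w k} →
      ∃ α β γ : ℝ, 0 ≤ α ∧ 0 ≤ β ∧ 0 ≤ γ ∧ α + β + γ = 1 ∧
        α • w i + β • w j + γ • w k = p := by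
    intro i j k p hp
    rw [convexHull_insert (by simp), convexHull_pair] at hp
    simp only [mem_convexJoin, mem_singleton_iff, exists_eq_left] at hp
    obtain ⟨z, ⟨s, t, hs, ht, hst, rfl⟩, ⟨x, y, hx, hy, hxy, rfl⟩⟩ := hp
    refine ⟨x, y * s, y * t, hx, by positivity, by positivity, ?_, ?_⟩
    · rw [add_assoc, ← mul_add, hst, mul_one, hxy]
    · rw [smul_add, smul_smul, smul_smul, add_assoc]
  refine ⟨fun p => if h : ∃ c, IsBary w D p c then ∑ l, h.choose l • a l else 0, ⟨?_, ?_⟩, ?_⟩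
  · intro i j k hf α β γ hα hβ hγ h1
    have hb := isBary_single (w := w) hf hα hβ hγ h1
    have h : ∃ c, IsBary w D (α • w i + β • w j + γ • w k) c := ⟨_, hb⟩
    have e := h.choose_spec.unique hw hD hb
    simp only [dif_pos h]
    rw [e]
    simp [add_smul, Finset.sum_add_distrib, Pi.single_apply, ite_smul]
  · intro p hp
    refine dif_neg ?_
    rintro ⟨c, c0, c1, rfl, -⟩
    refine hp ((convex_convexHull ℝ _).sum_mem (fun l _ => c0 l) c1 fun l _ => ?_)
    exact subset_convexHull ℝ _ (mem_range_self l)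
  · intro G hG
    funext p
    by_cases hp : p ∈ convexPolygon w
    · obtain ⟨i, j, k, hf, hpf⟩ := hD.cover p hp
      obtain ⟨α, β, γ, hα, hβ, hγ, h1, rfl⟩ := comb hpf
      have hb := isBary_single (w := w) hf hα hβ hγ h1
      have h : ∃ c, IsBary w D (α • w i + β • w j + γ • w k) c := ⟨_, hb⟩
      have e := h.choose_spec.unique hw hD hb
      rw [hG.affine i j k hf α β γ hα hβ hγ h1]
      simp only [dif_pos h]
      rw [e]
      simp [add_smul, Finset.sum_add_distrib, Pi.single_apply, ite_smul]
    · rw [hG.zero_off p hp, dif_neg]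
      rintro ⟨c, c0, c1, rfl, -⟩
      refine hp ((convex_convexHull ℝ _).sum_mem (fun l _ => c0 l) c1 fun l _ => ?_)
      exact subset_convexHull ℝ _ (mem_range_self l)

theorem plMap_spec (hw : IsConvexCCW w) (hD : IsTriangulation w D) (a : Fin n → ℂ × ℂ) :
    IsPLMap w D a (plMap w D a) :=
  Classical.epsilon_spec (existsUnique_isPLMap hw hD a).exists

end Existence

/-! ### The polygonal measure -/

/-- The density of the pull-back `F^*(dx ∧ dy)` with respect to the area form of the plane, i.e.
the Jacobian determinant of the pair of complex functions `(x ∘ F, y ∘ F)`. -/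
noncomputable def jacobian (F : ℂ → ℂ × ℂ) (p : ℂ) : ℂ :=
  (fderiv ℝ F p 1).1 * (fderiv ℝ F p Complex.I).2 -
    (fderiv ℝ F p Complex.I).1 * (fderiv ℝ F p 1).2

/-- The polygonal measure: the complex measure on `ℂ²` that is the direct image under `F_{a,D}` of
the complex measure `F_{a,D}^*(dx ∧ dy)` on the auxiliary polygon. -/
noncomputable def polygonalMeasure {n : ℕ} (w : Fin n → ℂ) (D : Set (Sym2 (Fin n)))
    (a : Fin n → ℂ × ℂ) : ComplexMeasure (ℂ × ℂ) :=
  ((volume.restrict (convexPolygon w)).withDensityᵥ (jacobian (plMap w D a))).map (plMap w D a)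

/-! ### One-forms on `ℂ²` and their integrals along the closed polygonal curve -/

/-- The 2-form `dz ∧ dz̄` on `ℂ²`, where `z = x + i y` and `z̄ = x - i y`. -/
noncomputable def dzdzbar (u v : ℂ × ℂ) : ℂ :=
  (u.1 + Complex.I * u.2) * (v.1 - Complex.I * v.2) -
    (v.1 + Complex.I * v.2) * (u.1 - Complex.I * u.2)

/-- The exterior derivative of a complex-valued 1-form on `ℂ²`. -/
noncomputable def dForm (ω : ℂ × ℂ → (ℂ × ℂ →L[ℝ] ℂ)) (p u v : ℂ × ℂ) : ℂ :=
  extDeriv (fun x => ContinuousAlternatingMap.ofSubsingleton ℝ (ℂ × ℂ) ℂ (0 : Fin 1) (ω x)) p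
    ![u, v]

/-- The integral of a 1-form along the oriented closed polygonal curve with vertices `a j`. -/
noncomputable def closedPolygonIntegral {n : ℕ} (a : Fin n → ℂ × ℂ)
    (ω : ℂ × ℂ → (ℂ × ℂ →L[ℝ] ℂ)) : ℂ :=
  ∑ j, curveIntegral ω (Path.segment (a j) (a (finRotate n j)))

/-! ### Real vertices -/

/-- The inclusion of the real plane into `ℂ²`. -/
def realPoint (q : ℂ) : ℂ × ℂ := ((q.re : ℂ), (q.im : ℂ))

/-- The closed polygonal curve in the real plane, as a set. -/
def closedPolygon {n : ℕ} (b : Fin n → ℂ) : Set ℂ :=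
  ⋃ j, segment ℝ (b j) (b (finRotate n j))

/-- The winding number `(2πi)⁻¹ ∮ dz / (z - q)` of the closed polygonal curve around `q` (the
linking number of the curve with `q - ∞`). -/
noncomputable def windingNumber {n : ℕ} (b : Fin n → ℂ) (q : ℂ) : ℂ :=
  (2 * Real.pi * Complex.I)⁻¹ *
    ∑ j, curveIntegral (fun z : ℂ => (z - q)⁻¹ • ContinuousLinearMap.id ℂ ℂ)
      (Path.segment (b j) (b (finRotate n j)))

/-- `P` is the (automatically simply connected) plane polygon with vertices `b j`, listed
counterclockwise: `P` is compact, its boundary is the polygonal curve through the vertices, this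
curve has no self-intersections, and `P` lies to the left of each side. -/
structure IsCCWPolygon {n : ℕ} (b : Fin n → ℂ) (P : Set ℂ) : Prop where
  isCompact : IsCompact P
  frontier_eq : frontier P = closedPolygon b
  simple : ∀ j k : Fin n, ∀ s ∈ Ico (0 : ℝ) 1, ∀ t ∈ Ico (0 : ℝ) 1,
    AffineMap.lineMap (b j) (b (finRotate n j)) s = AffineMap.lineMap (b k) (b (finRotate n k)) t →
      j = k ∧ s = t
  left : ∀ j : Fin n, ∀ t ∈ Ioo (0 : ℝ) 1, ∀ᶠ ε : ℝ in 𝓝[>] 0,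
    AffineMap.lineMap (b j) (b (finRotate n j)) t +
      ε • (Complex.I * (b (finRotate n j) - b j)) ∈ P

end PolygonalMeasure

open PolygonalMeasure

/-!
On each face of the triangulation the map `F` is affine, with constant Jacobian. Hence the polygonal
measure is a finite sum, over the faces `(i, j, k)`, of images of the area of a standard triangle
under the affine maps onto the triangles `a i, a j, a k` of `ℂ²`, each multiplied by the complex
area `(dx ∧ dy) (a j - a i, a k - a i)` (`polygonalMeasure_apply`, `integral_polygonalMeasure`).

For arbitrary vertices, Stokes' theorem for an affine triangle (`integral_dForm_triangle`) turns the
term of a face in `∫ h dμ` into the integral of `ω` along its boundary, for every primitive `ω` of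
`h dx ∧ dy`. Every diagonal lies on exactly two faces, on opposite sides, and every side of the
polygon on exactly one, so that the boundaries of the faces add up to the closed polygonal curve
(`sum_faces_boundary`); this gives the formula `∫ h dμ = ∮ ω`. A holomorphic `h` has a primitive
`ω = H dy`, where `H` is a holomorphic function with `∂H/∂x = h` (`exists_primitive`), and the
right-hand side does not involve the triangulation, so neither does the left-hand side.

For real vertices, the term of a face is the image triangle with its Lebesgue measure, taken with
the sign of its orientation, and that sign, extended by zero, is the winding number of the boundary
of the triangle (`sum_log_triangle`). The same cancellation of diagonals, applied to the form
`dz / (z - q)`, shows that the terms add up to the winding number of the whole curve at almost every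
`q` (`windingNumber_eq_sum_triIndex`, `polygonalMeasure_real`). It is integer-valued and continuous,
hence locally constant, off the curve.

For a simple counterclockwise polygon `P`, the winding number and the indicator function of `P` jump
by the same amount across each side, so their difference extends to a locally constant function off
the finitely many vertices (`IsCCWPolygon.exists_eventually_defect_eq`). The complement of a finite
set in the plane is connected and the difference vanishes far away, so it is zero.
-/

namespace PolygonalMeasure

/-! ### Affine triangles -/

/-- The open standard triangle, with vertices `0`, `1` and `I`. -/
def stdTriangle : Set ℂ := {p | 0 < p.re ∧ 0 < p.im ∧ p.re + p.im < 1}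

/-- The real affine map that sends `0`, `1`, `I` to `u`, `v`, `w`. -/
def triMap {E : Type*} [AddCommGroup E] [Module ℝ E] (u v w : E) (p : ℂ) : E :=
  u + (p.re • (v - u) + p.im • (w - u))

/-- The open triangle with vertices `u`, `v`, `w`; it is degenerate (a point or an open segment)
when the vertices are collinear. -/
def openTriangle (u v w : ℂ) : Set ℂ := triMap u v w '' stdTriangle

/-- The inverse of `triMap u v w` for non-collinear `u`, `v`, `w`, by Cramer's rule. -/
noncomputable def triCoord (u v w q : ℂ) : ℂ :=
  ⟨cross (q - u) (w - u) / cross (v - u) (w - u), cross (v - u) (q - u) / cross (v - u) (w - u)⟩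

theorem triMap_eq_sum {E : Type*} [AddCommGroup E] [Module ℝ E] (u v w : E) (p : ℂ) :
    triMap u v w p = (1 - p.re - p.im) • u + p.re • v + p.im • w := by
  unfold triMap; module

theorem triMap_mem_convexHull {E : Type*} [AddCommGroup E] [Module ℝ E] (u v w : E) {p : ℂ}
    (hp : p ∈ stdTriangle) : triMap u v w p ∈ convexHull ℝ {u, v, w} := by
  obtain ⟨h1, h2, h3⟩ := hp
  rw [triMap_eq_sum]
  have hu : u ∈ convexHull ℝ {u, v, w} := subset_convexHull ℝ _ (by simp)
  have hv : v ∈ convexHull ℝ {u, v, w} := subset_convexHull ℝ _ (by simp)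
  have hw : w ∈ convexHull ℝ {u, v, w} := subset_convexHull ℝ _ (by simp)
  have := (convex_convexHull ℝ {u, v, w}).sum_mem (t := Finset.univ)
    (w := ![1 - p.re - p.im, p.re, p.im]) (z := ![u, v, w])
    (by intro i _; fin_cases i <;> simp <;> linarith)
    (by simp [Fin.sum_univ_succ]) (by intro i _; fin_cases i <;> simp <;> assumption)
  simpa [Fin.sum_univ_succ, add_assoc] using this

theorem openTriangle_subset_convexHull (u v w : ℂ) :
    openTriangle u v w ⊆ convexHull ℝ {u, v, w} := by
  rintro _ ⟨p, hp, rfl⟩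
  exact triMap_mem_convexHull u v w hp

theorem isOpen_stdTriangle : IsOpen stdTriangle :=
  (isOpen_lt continuous_const Complex.continuous_re).inter
    ((isOpen_lt continuous_const Complex.continuous_im).inter
      (isOpen_lt (Complex.continuous_re.add Complex.continuous_im) continuous_const))

theorem convex_stdTriangle : Convex ℝ stdTriangle := by
  intro x hx y hy a b ha hb hab
  obtain ⟨x1, x2, x3⟩ := hx
  obtain ⟨y1, y2, y3⟩ := hy
  simp only [stdTriangle, mem_ofPred_eq, Complex.add_re, Complex.add_im, Complex.real_smul,
    Complex.re_ofReal_mul, Complex.im_ofReal_mul]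
  rcases ha.eq_or_lt with rfl | ha
  · simp only [zero_add] at hab
    subst hab
    simpa using ⟨y1, y2, y3⟩
  · refine ⟨by positivity, by positivity, ?_⟩
    nlinarith [mul_lt_mul_of_pos_left x3 ha, mul_le_mul_of_nonneg_left y3.le hb]

theorem continuous_triMap {E : Type*} [AddCommGroup E] [Module ℝ E] [TopologicalSpace E]
    [ContinuousAdd E] [ContinuousSMul ℝ E] (u v w : E) : Continuous (triMap u v w) := by
  unfold triMap; fun_prop

theorem triCoord_triMap {u v w : ℂ} (h : cross (v - u) (w - u) ≠ 0) (p : ℂ) :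
    triCoord u v w (triMap u v w p) = p := by
  unfold triCoord triMap
  apply Complex.ext <;> simp only <;> rw [div_eq_iff h] <;>
    simp only [cross, Complex.sub_re, Complex.sub_im, Complex.add_re, Complex.add_im,
      Complex.real_smul, Complex.re_ofReal_mul, Complex.im_ofReal_mul] <;> ring

theorem triMap_triCoord {u v w : ℂ} (h : cross (v - u) (w - u) ≠ 0) (q : ℂ) :
    triMap u v w (triCoord u v w q) = q := by
  unfold triCoord triMap
  apply Complex.ext <;>
    simp only [Complex.add_re, Complex.add_im,
      Complex.real_smul, Complex.re_ofReal_mul, Complex.im_ofReal_mul] <;>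
    field_simp <;>
    simp only [cross, Complex.sub_re, Complex.sub_im] <;> ring

theorem continuous_triCoord (u v w : ℂ) : Continuous (triCoord u v w) := by
  have : triCoord u v w = fun q => Complex.equivRealProdCLM.symm
      (cross (q - u) (w - u) / cross (v - u) (w - u),
        cross (v - u) (q - u) / cross (v - u) (w - u)) := by
    funext q; apply Complex.ext <;> simp [triCoord]
  rw [this]
  refine Complex.equivRealProdCLM.symm.continuous.comp ?_
  unfold cross
  fun_prop

theorem openTriangle_eq_preimage {u v w : ℂ} (h : cross (v - u) (w - u) ≠ 0) :
    openTriangle u v w = triCoord u v w ⁻¹' stdTriangle := by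
  ext q
  constructor
  · rintro ⟨p, hp, rfl⟩
    rwa [mem_preimage, triCoord_triMap h]
  · intro hq
    exact ⟨_, hq, triMap_triCoord h q⟩

theorem isOpen_openTriangle {u v w : ℂ} (h : cross (v - u) (w - u) ≠ 0) :
    IsOpen (openTriangle u v w) := by
  rw [openTriangle_eq_preimage h]
  exact isOpen_stdTriangle.preimage (continuous_triCoord u v w)

theorem convex_openTriangle (u v w : ℂ) : Convex ℝ (openTriangle u v w) := by
  rintro _ ⟨x, hx, rfl⟩ _ ⟨y, hy, rfl⟩ a b ha hb hab
  refine ⟨a • x + b • y, convex_stdTriangle hx hy ha hb hab, ?_⟩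
  rw [eq_sub_iff_add_eq.2 hab]
  apply Complex.ext <;>
    simp only [triMap, Complex.add_re, Complex.add_im, Complex.sub_re, Complex.sub_im,
      Complex.real_smul, Complex.re_ofReal_mul, Complex.im_ofReal_mul] <;> ring

theorem mem_closure_stdTriangle {p : ℂ} (h1 : 0 ≤ p.re) (h2 : 0 ≤ p.im) (h3 : p.re + p.im ≤ 1) :
    p ∈ closure stdTriangle := by
  have ht : Filter.Tendsto (fun t : ℝ => (1 - t) • p + t • (⟨1 / 4, 1 / 4⟩ : ℂ)) (𝓝[>] 0)
      (𝓝 p) := by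
    have : Continuous fun t : ℝ => (1 - t) • p + t • (⟨1 / 4, 1 / 4⟩ : ℂ) := by fun_prop
    have h := this.tendsto 0
    simp only [sub_zero, one_smul, zero_smul, add_zero] at h
    exact h.mono_left nhdsWithin_le_nhds
  refine mem_closure_of_tendsto ht ?_
  filter_upwards [Ioo_mem_nhdsGT (zero_lt_one' ℝ)] with t ht
  obtain ⟨t0, t1⟩ := ht
  have t2 : 0 < 1 - t := by linarith
  simp only [stdTriangle, mem_ofPred_eq, Complex.add_re, Complex.add_im, Complex.real_smul,
    Complex.re_ofReal_mul, Complex.im_ofReal_mul]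
  refine ⟨by positivity, by positivity, ?_⟩
  nlinarith

theorem convexHull_subset_closure_openTriangle (u v w : ℂ) :
    convexHull ℝ {u, v, w} ⊆ closure (openTriangle u v w) := by
  refine convexHull_min ?_ (convex_openTriangle u v w).closure
  have key : ∀ p ∈ closure stdTriangle, triMap u v w p ∈ closure (openTriangle u v w) :=
    fun p hp => image_closure_subset_closure_image (continuous_triMap u v w) (mem_image_of_mem _ hp)
  rintro q (rfl | rfl | rfl)
  · simpa [triMap] using key 0 (mem_closure_stdTriangle (by simp) (by simp) (by simp))
  · simpa [triMap] using key 1 (mem_closure_stdTriangle (by simp) (by simp) (by simp))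
  · simpa [triMap] using key Complex.I (mem_closure_stdTriangle (by simp) (by simp) (by simp))

theorem volume_convexHull_sdiff_openTriangle {u v w : ℂ} (h : cross (v - u) (w - u) ≠ 0) :
    volume (convexHull ℝ {u, v, w} \ openTriangle u v w) = 0 := by
  refine measure_mono_null ?_ ((convex_openTriangle u v w).addHaar_frontier volume)
  rw [(isOpen_openTriangle h).frontier_eq]
  exact sdiff_subset_sdiff_left (convexHull_subset_closure_openTriangle u v w)

/-- The real linear map that sends `1` to `a` and `I` to `b`; the linear part of `triMap u v w` is
`triLin (v - u) (w - u)`. -/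
noncomputable def triLin (a b : ℂ) : ℂ →L[ℝ] ℂ :=
  Complex.reCLM.smulRight a + Complex.imCLM.smulRight b

theorem det_triLin (a b : ℂ) : (triLin a b).det = cross a b := by
  have : LinearMap.det (triLin a b : ℂ →ₗ[ℝ] ℂ) = cross a b := by
    rw [← LinearMap.det_toMatrix Complex.basisOneI, Matrix.det_fin_two]
    simp [LinearMap.toMatrix_apply, triLin, cross]
    ring
  exact this

theorem hasFDerivAt_triMap (u v w p : ℂ) :
    HasFDerivAt (triMap u v w) (triLin (v - u) (w - u)) p := by
  have : triMap u v w = fun p => u + triLin (v - u) (w - u) p := by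
    funext p; simp [triMap, triLin]
  rw [this]
  exact (triLin (v - u) (w - u)).hasFDerivAt.const_add u

theorem setIntegral_openTriangle {E : Type*} [NormedAddCommGroup E] [NormedSpace ℝ E] {u v w : ℂ}
    (h : cross (v - u) (w - u) ≠ 0) (g : ℂ → E) :
    ∫ q in openTriangle u v w, g q =
      |cross (v - u) (w - u)| • ∫ p in stdTriangle, g (triMap u v w p) := by
  unfold openTriangle
  rw [integral_image_eq_integral_abs_det_fderiv_smul volume isOpen_stdTriangle.measurableSet
    (fun p _ => (hasFDerivAt_triMap u v w p).hasFDerivWithinAt)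
    (fun p _ q _ hpq => by rw [← triCoord_triMap h p, hpq, triCoord_triMap h q])]
  simp only [det_triLin]
  exact integral_smul _ _

theorem isCompact_triangle (u v w : ℂ) : IsCompact (convexHull ℝ {u, v, w}) :=
  ((finite_singleton w).insert v |>.insert u).isCompact_convexHull (𝕜 := ℝ)

theorem volume_openTriangle_lt_top (u v w : ℂ) : volume (openTriangle u v w) < ⊤ :=
  (measure_mono (openTriangle_subset_convexHull u v w)).trans_lt
    (isCompact_triangle u v w).measure_lt_top

/-! ### Integrals against vector measures with a density -/

section VectorIntegral

variable {X E F G : Type*} [MeasurableSpace X] [NormedAddCommGroup E] [NormedSpace ℝ E]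
  [NormedAddCommGroup F] [NormedSpace ℝ F] [NormedAddCommGroup G] [NormedSpace ℝ G]

theorem integrable_bilin_of_bounded {μ : Measure X} {g : X → F} (hg : Integrable g μ)
    (B : E →L[ℝ] F →L[ℝ] G) {f : X → E} (hf : StronglyMeasurable f) {C : ℝ}
    (hC : ∀ x, ‖f x‖ ≤ C) : Integrable (fun x => B (f x) (g x)) μ := by
  refine (hg.norm.const_mul (‖B‖ * C)).mono'
    (B.aestronglyMeasurable_comp₂ hf.aestronglyMeasurable hg.1) (ae_of_all _ fun x => ?_)
  calc ‖B (f x) (g x)‖ ≤ ‖B‖ * ‖f x‖ * ‖g x‖ := B.le_opNorm₂ _ _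
    _ ≤ ‖B‖ * C * ‖g x‖ := by gcongr; exact hC x

variable [CompleteSpace F] [CompleteSpace G]

theorem isFiniteMeasure_variation_withDensity {μ : Measure X} {g : X → F} (hg : Integrable g μ) :
    IsFiniteMeasure (μ.withDensityᵥ g).variation := by
  rw [Measure.variation_withDensityᵥ hg]
  exact ⟨by simpa using! hg.2⟩

theorem integral_withDensity_simpleFunc {μ : Measure X} {g : X → F} (hg : Integrable g μ)
    (B : E →L[ℝ] F →L[ℝ] G) (f : SimpleFunc X E) :
    ∫ᵛ x, f x ∂[B; μ.withDensityᵥ g] = ∫ x, B (f x) (g x) ∂μ := by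
  have := isFiniteMeasure_variation_withDensity hg
  induction f using SimpleFunc.induction with
  | const c hs =>
    rename_i s
    have h1 := VectorMeasure.integral_indicator_const (μ := μ.withDensityᵥ g) (B := B) c hs
    have h2 : (fun x => B (s.indicator (fun _ => c) x) (g x)) =
        s.indicator fun x => B c (g x) := by
      funext x
      by_cases hx : x ∈ s <;> simp [hx]
    have h3 : ⇑(SimpleFunc.piecewise s hs (SimpleFunc.const X c) (SimpleFunc.const X 0)) =
        s.indicator fun _ => c := by
      classical
      rw [SimpleFunc.coe_piecewise]
      exact piecewise_eq_indicator
    rw [h3]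
    rw [h1, h2, MeasureTheory.integral_indicator hs, withDensityᵥ_apply hg hs,
      (B c).integral_comp_comm hg.integrableOn]
  | add hd hf hg' =>
    rename_i f₁ f₂
    have i (f : SimpleFunc X E) : Integrable f (μ.withDensityᵥ g).variation :=
      f.integrable_of_isFiniteMeasure
    have j (f : SimpleFunc X E) : Integrable (fun x => B (f x) (g x)) μ := by
      obtain ⟨C, hC⟩ := f.exists_forall_norm_le
      exact integrable_bilin_of_bounded hg B f.stronglyMeasurable hC
    simp only [SimpleFunc.coe_add, Pi.add_apply, map_add, _root_.add_apply]
    rw [VectorMeasure.integral_fun_add (i f₁) (i f₂), hf, hg',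
      MeasureTheory.integral_add (j f₁) (j f₂)]

/-- The integral of a bounded function against a vector measure with density `g`. Both sides are
continuous under bounded pointwise limits, so simple functions suffice. -/
theorem integral_withDensity_of_bounded {μ : Measure X} {g : X → F} (hg : Integrable g μ)
    (B : E →L[ℝ] F →L[ℝ] G) {f : X → E} (hf : StronglyMeasurable f) {C : ℝ}
    (hC : ∀ x, ‖f x‖ ≤ C) :
    ∫ᵛ x, f x ∂[B; μ.withDensityᵥ g] = ∫ x, B (f x) (g x) ∂μ := by
  have := isFiniteMeasure_variation_withDensity hg
  rcases isEmpty_or_nonempty X with hX | ⟨⟨x₀⟩⟩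
  · simp [VectorMeasure.integral_of_isEmpty, Measure.eq_zero_of_isEmpty]
  have hC0 : 0 ≤ C := (norm_nonneg _).trans (hC x₀)
  have hlim : ∀ x, Filter.Tendsto (fun k => hf.approxBounded C k x) Filter.atTop (𝓝 (f x)) :=
    fun x => hf.tendsto_approxBounded_of_norm_le (hC x)
  have hb : ∀ k x, ‖hf.approxBounded C k x‖ ≤ C := fun k x => hf.norm_approxBounded_le hC0 k x
  have h1 := VectorMeasure.tendsto_integral_of_dominated_convergence (μ := μ.withDensityᵥ g)
    (B := B)
    (fun _ => C)
    (fun k => (hf.approxBounded C k).stronglyMeasurable.aestronglyMeasurable)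
    (integrable_const C) (fun k => ae_of_all _ (hb k)) (ae_of_all _ hlim)
  have h2 := MeasureTheory.tendsto_integral_of_dominated_convergence (μ := μ)
    (F := fun k x => B (hf.approxBounded C k x) (g x)) (f := fun x => B (f x) (g x))
    (fun x => ‖B‖ * C * ‖g x‖)
    (fun k => B.aestronglyMeasurable_comp₂
      (hf.approxBounded C k).stronglyMeasurable.aestronglyMeasurable hg.1)
    (hg.norm.const_mul _)
    (fun k => ae_of_all _ fun x => (B.le_opNorm₂ _ _).trans (by gcongr; exact hb k x))
    (ae_of_all _ fun x => by
      have : Continuous fun y => B y (g x) := by fun_prop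
      exact (this.tendsto _).comp (hlim x))
  simp only [integral_withDensity_simpleFunc hg] at h1
  exact tendsto_nhds_unique h1 h2

end VectorIntegral

/-! ### The piecewise affine map on the faces of a triangulation -/

section Faces

variable {n : ℕ} {w : Fin n → ℂ} {D : Set (Sym2 (Fin n))} {a : Fin n → ℂ × ℂ}

/-- The determinant `u₁ v₂ - v₁ u₂` of two vectors of `ℂ²`, i.e. `(dx ∧ dy) (u, v)`. -/
def area (u v : ℂ × ℂ) : ℂ := u.1 * v.2 - v.1 * u.2

open Classical in
/-- The triangles `(i, j, k)` into which `D` cuts the polygon. -/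
noncomputable def faces (D : Set (Sym2 (Fin n))) : Finset (Fin n × Fin n × Fin n) :=
  Finset.univ.filter fun f => IsFace D f.1 f.2.1 f.2.2

theorem mem_faces {f : Fin n × Fin n × Fin n} : f ∈ faces D ↔ IsFace D f.1 f.2.1 f.2.2 := by
  classical
  simp [faces]

theorem cross_face_pos (hw : IsConvexCCW w) {i j k : Fin n} (hf : IsFace D i j k) :
    0 < cross (w j - w i) (w k - w i) := hw i j k hf.1 hf.2.1

theorem isBary_triMap {i j k : Fin n} (hf : IsFace D i j k) {p : ℂ} (hp : p ∈ stdTriangle) :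
    IsBary w D (triMap (w i) (w j) (w k) p)
      (Pi.single i (1 - p.re - p.im) + Pi.single j p.re + Pi.single k p.im) := by
  rw [triMap_eq_sum]
  exact isBary_single hf (by linarith [hp.2.2]) hp.1.le hp.2.1.le (by ring)

theorem disjoint_openTriangle (hw : IsConvexCCW w) (hD : IsTriangulation w D)
    {i j k i' j' k' : Fin n}
    (hf : IsFace D i j k) (hf' : IsFace D i' j' k') (hne : (i, j, k) ≠ (i', j', k')) :
    Disjoint (openTriangle (w i) (w j) (w k)) (openTriangle (w i') (w j') (w k')) := by
  rw [Set.disjoint_left]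
  rintro _ ⟨p, hp, rfl⟩ ⟨q, hq, hpq⟩
  have h1 := isBary_triMap (w := w) hf hp
  have h2 := isBary_triMap (w := w) hf' hq
  rw [hpq] at h2
  have h3 := h1.unique hw hD h2
  obtain ⟨p1, p2, p3⟩ := hp
  obtain ⟨q1, q2, q3⟩ := hq
  obtain ⟨hij, hjk, -⟩ := hf
  obtain ⟨hij', hjk', -⟩ := hf'
  have key : ∀ l, (l = i ∨ l = j ∨ l = k) ↔ (l = i' ∨ l = j' ∨ l = k') := by
    intro l
    have h4 := congrFun h3 l
    have nn : ∀ (i j k : Fin n) (α β γ : ℝ), 0 < α → 0 < β → 0 < γ →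
        ((l = i ∨ l = j ∨ l = k) ↔
          0 < (Pi.single i α + Pi.single j β + Pi.single k γ : Fin n → ℝ) l) := by
      intro i j k α β γ hα hβ hγ
      simp only [Pi.add_apply, Pi.single_apply]
      split_ifs <;> simp_all <;> positivity
    have p0 : 0 < 1 - p.re - p.im := by linarith
    have q0 : 0 < 1 - q.re - q.im := by linarith
    rw [nn i j k _ _ _ p0 p1 p2, nn i' j' k' _ _ _ q0 q1 q2, h4]
  apply hne
  have a1 := key i; have a2 := key j; have a3 := key k
  have b1 := key i'; have b2 := key j'; have b3 := key k'
  simp only [true_or, or_true, true_iff, iff_true] at a1 a2 a3 b1 b2 b3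
  simp only [Prod.mk.injEq, Fin.ext_iff, Fin.lt_def] at *
  omega

theorem ae_eq_polygon (hw : IsConvexCCW w) (hD : IsTriangulation w D) :
    (⋃ f ∈ faces D, openTriangle (w f.1) (w f.2.1) (w f.2.2) : Set ℂ) =ᵐ[volume]
      convexPolygon w := by
  refine (LE.le.eventuallyLE ?_).antisymm (ae_le_set.2 ?_)
  · refine iUnion₂_subset fun f _ => ?_
    exact (openTriangle_subset_convexHull _ _ _).trans convexHull_triple_subset
  · refine measure_mono_null (t := ⋃ f ∈ faces D, (convexHull ℝ {w f.1, w f.2.1, w f.2.2} \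
      openTriangle (w f.1) (w f.2.1) (w f.2.2))) ?_ ?_
    · rintro p ⟨hp, hp'⟩
      obtain ⟨i, j, k, hf, hpf⟩ := hD.cover p hp
      simp only [mem_iUnion, not_exists] at hp' ⊢
      exact ⟨(i, j, k), mem_faces.2 hf, hpf, hp' (i, j, k) (mem_faces.2 hf)⟩
    · refine (measure_biUnion_null_iff (faces D).countable_toSet).2 fun f hf => ?_
      exact volume_convexHull_sdiff_openTriangle (cross_face_pos hw (mem_faces.1 hf)).ne'

theorem plMap_triMap (hw : IsConvexCCW w) (hD : IsTriangulation w D) {i j k : Fin n}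
    (hf : IsFace D i j k) {p : ℂ} (hp : p ∈ stdTriangle) :
    plMap w D a (triMap (w i) (w j) (w k) p) = triMap (a i) (a j) (a k) p := by
  rw [triMap_eq_sum, triMap_eq_sum]
  exact (plMap_spec hw hD a).affine i j k hf _ _ _ (by linarith [hp.2.2]) hp.1.le hp.2.1.le
    (by ring)

theorem differentiableAt_plMap (hw : IsConvexCCW w) (hD : IsTriangulation w D) {i j k : Fin n}
    (hf : IsFace D i j k) {q : ℂ} (hq : q ∈ openTriangle (w i) (w j) (w k)) :
    DifferentiableAt ℝ (plMap w D a) q := by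
  have hc := (cross_face_pos hw hf).ne'
  have h1 : plMap w D a =ᶠ[𝓝 q] fun q => triMap (a i) (a j) (a k)
      (triCoord (w i) (w j) (w k) q) := by
    filter_upwards [(isOpen_openTriangle hc).mem_nhds hq] with x hx
    rw [← plMap_triMap hw hD hf (by rwa [openTriangle_eq_preimage hc] at hx), triMap_triCoord hc]
  refine DifferentiableAt.congr_of_eventuallyEq ?_ h1
  simp only [triMap, triCoord, cross]
  fun_prop

/-- The Jacobian of the piecewise affine map is constant on each triangle. -/
theorem jacobian_plMap (hw : IsConvexCCW w) (hD : IsTriangulation w D) {i j k : Fin n}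
    (hf : IsFace D i j k) {q : ℂ} (hq : q ∈ openTriangle (w i) (w j) (w k)) :
    cross (w j - w i) (w k - w i) * jacobian (plMap w D a) q = area (a j - a i) (a k - a i) := by
  have hd := (differentiableAt_plMap (a := a) hw hD hf hq).hasFDerivAt
  obtain ⟨p, hp, rfl⟩ := hq
  set L := fderiv ℝ (plMap w D a) (triMap (w i) (w j) (w k) p) with hL
  have h1 := hd.comp p (hasFDerivAt_triMap (w i) (w j) (w k) p)
  have h2 : plMap w D a ∘ triMap (w i) (w j) (w k) =ᶠ[𝓝 p] triMap (a i) (a j) (a k) := by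
    filter_upwards [isOpen_stdTriangle.mem_nhds hp] with x hx
    exact plMap_triMap hw hD hf hx
  have h3 : HasFDerivAt (triMap (a i) (a j) (a k))
      (Complex.reCLM.smulRight (a j - a i) + Complex.imCLM.smulRight (a k - a i)) p := by
    have : triMap (a i) (a j) (a k) = fun p => a i +
        (Complex.reCLM.smulRight (a j - a i) + Complex.imCLM.smulRight (a k - a i)) p := by
      funext p; simp [triMap]
    rw [this]
    exact ContinuousLinearMap.hasFDerivAt _ |>.const_add (a i)
  have h4 := (h1.congr_of_eventuallyEq h2.symm).unique h3
  have e1 : L (w j - w i) = a j - a i := by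
    simpa [triLin] using DFunLike.congr_fun h4 1
  have e2 : L (w k - w i) = a k - a i := by
    simpa [triLin] using DFunLike.congr_fun h4 Complex.I
  have lin : ∀ z : ℂ, L z = z.re • L 1 + z.im • L Complex.I := by
    intro z
    rw [← map_smul, ← map_smul, ← map_add]
    congr 1
    apply Complex.ext <;> simp
  rw [← e1, ← e2, lin (w j - w i), lin (w k - w i)]
  simp only [jacobian, ← hL, area, cross, Prod.fst_add, Prod.snd_add, Prod.smul_fst, Prod.smul_snd,
    Complex.real_smul]
  push_cast
  ring

end Faces

/-! ### The polygonal measure as a sum over the faces -/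

section Sum

variable {n : ℕ} {w : Fin n → ℂ} {D : Set (Sym2 (Fin n))} {a : Fin n → ℂ × ℂ}

theorem triCoord_mem_of_mem_convexHull {u v w : ℂ} (h : cross (v - u) (w - u) ≠ 0) {q : ℂ}
    (hq : q ∈ convexHull ℝ {u, v, w}) :
    0 ≤ (triCoord u v w q).re ∧ 0 ≤ (triCoord u v w q).im ∧
      (triCoord u v w q).re + (triCoord u v w q).im ≤ 1 := by
  have h1 := convexHull_subset_closure_openTriangle u v w hq
  have hcl : IsClosed {p : ℂ | 0 ≤ p.re ∧ 0 ≤ p.im ∧ p.re + p.im ≤ 1} :=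
    (isClosed_le continuous_const Complex.continuous_re).inter
      ((isClosed_le continuous_const Complex.continuous_im).inter
        (isClosed_le (Complex.continuous_re.add Complex.continuous_im) continuous_const))
  refine closure_minimal (t := triCoord u v w ⁻¹' {p : ℂ | 0 ≤ p.re ∧ 0 ≤ p.im ∧ p.re + p.im ≤ 1})
    ?_ (hcl.preimage (continuous_triCoord u v w)) h1
  rw [openTriangle_eq_preimage h]
  exact preimage_mono fun p hp => ⟨hp.1.le, hp.2.1.le, hp.2.2.le⟩

theorem plMap_eq_of_mem_face (hw : IsConvexCCW w) (hD : IsTriangulation w D) {i j k : Fin n}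
    (hf : IsFace D i j k) {q : ℂ} (hq : q ∈ convexHull ℝ {w i, w j, w k}) :
    plMap w D a q = triMap (a i) (a j) (a k) (triCoord (w i) (w j) (w k) q) := by
  have hc := (cross_face_pos hw hf).ne'
  obtain ⟨h1, h2, h3⟩ := triCoord_mem_of_mem_convexHull hc hq
  conv_lhs => rw [← triMap_triCoord hc q]
  rw [triMap_eq_sum, triMap_eq_sum]
  exact (plMap_spec hw hD a).affine i j k hf _ _ _ (by linarith) h1 h2 (by ring)

theorem isCompact_convexPolygon (w : Fin n → ℂ) : IsCompact (convexPolygon w) :=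
  (finite_range w).isCompact_convexHull (𝕜 := ℝ)

theorem measurable_plMap (hw : IsConvexCCW w) (hD : IsTriangulation w D) :
    Measurable (plMap w D a) := by
  intro B hB
  have hP := (isCompact_convexPolygon w).isClosed.measurableSet
  have key : plMap w D a ⁻¹' B = ((convexPolygon w)ᶜ ∩ (fun _ => (0 : ℂ × ℂ)) ⁻¹' B) ∪
      ⋃ f ∈ faces D, (convexHull ℝ {w f.1, w f.2.1, w f.2.2} ∩
        (fun q => triMap (a f.1) (a f.2.1) (a f.2.2)
          (triCoord (w f.1) (w f.2.1) (w f.2.2) q)) ⁻¹' B) := by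
    ext q
    simp only [mem_union, mem_inter_iff, mem_compl_iff, mem_preimage, mem_iUnion, exists_prop]
    constructor
    · intro hq
      by_cases hqP : q ∈ convexPolygon w
      · obtain ⟨i, j, k, hf, hqf⟩ := hD.cover q hqP
        refine Or.inr ⟨(i, j, k), mem_faces.2 hf, hqf, ?_⟩
        rwa [plMap_eq_of_mem_face hw hD hf hqf] at hq
      · rw [(plMap_spec hw hD a).zero_off q hqP] at hq
        exact Or.inl ⟨hqP, hq⟩
    · rintro (⟨h1, h2⟩ | ⟨f, hf, h1, h2⟩)
      · rwa [(plMap_spec hw hD a).zero_off q h1]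
      · rwa [plMap_eq_of_mem_face hw hD (mem_faces.1 hf) h1]
  rw [key]
  refine (hP.compl.inter (measurable_const hB)).union
    (Finset.measurableSet_biUnion _ fun f _ => ?_)
  refine (isCompact_triangle _ _ _).isClosed.measurableSet.inter ?_
  exact ((continuous_triMap _ _ _).comp (continuous_triCoord _ _ _)).measurable hB

theorem plMap_mem (hw : IsConvexCCW w) (hD : IsTriangulation w D) (q : ℂ) :
    plMap w D a q ∈ convexHull ℝ (insert 0 (range a)) := by
  have ha : ∀ i, a i ∈ convexHull ℝ (insert 0 (range a)) := fun i =>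
    subset_convexHull ℝ _ (mem_insert_of_mem _ (mem_range_self i))
  by_cases hqP : q ∈ convexPolygon w
  · obtain ⟨i, j, k, hf, hqf⟩ := hD.cover q hqP
    obtain ⟨h1, h2, h3⟩ := triCoord_mem_of_mem_convexHull (cross_face_pos hw hf).ne' hqf
    rw [plMap_eq_of_mem_face hw hD hf hqf, triMap_eq_sum]
    set p := triCoord (w i) (w j) (w k) q
    have := (convex_convexHull ℝ (insert 0 (range a))).sum_mem (t := Finset.univ)
      (w := ![1 - p.re - p.im, p.re, p.im]) (z := ![a i, a j, a k])
      (by intro l _; fin_cases l <;> simp <;> linarith)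
      (by simp [Fin.sum_univ_succ]) (by intro l _; fin_cases l <;> simp [ha])
    simpa [Fin.sum_univ_succ, add_assoc] using this
  · rw [(plMap_spec hw hD a).zero_off q hqP]
    exact subset_convexHull ℝ _ (mem_insert _ _)

theorem exists_bound_comp_plMap (hw : IsConvexCCW w) (hD : IsTriangulation w D)
    {h : ℂ × ℂ → ℂ} (hh : Continuous h) : ∃ C, ∀ q, ‖h (plMap w D a q)‖ ≤ C := by
  obtain ⟨C, hC⟩ := (((finite_range a).insert 0).isCompact_convexHull (𝕜 := ℝ)).exists_bound_of_continuousOn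
    hh.continuousOn
  exact ⟨C, fun q => hC _ (plMap_mem hw hD q)⟩

theorem jacobian_eq_const (hw : IsConvexCCW w) (hD : IsTriangulation w D) {i j k : Fin n}
    (hf : IsFace D i j k) {q : ℂ} (hq : q ∈ openTriangle (w i) (w j) (w k)) :
    jacobian (plMap w D a) q =
      area (a j - a i) (a k - a i) / cross (w j - w i) (w k - w i) := by
  have hc : (cross (w j - w i) (w k - w i) : ℂ) ≠ 0 := by
    exact_mod_cast (cross_face_pos hw hf).ne'
  rw [eq_div_iff hc, mul_comm, jacobian_plMap hw hD hf hq]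

theorem integrableOn_jacobian (hw : IsConvexCCW w) (hD : IsTriangulation w D) :
    IntegrableOn (jacobian (plMap w D a)) (convexPolygon w) := by
  refine IntegrableOn.congr_set_ae ?_ (ae_eq_polygon hw hD).symm
  rw [integrableOn_finset_iUnion]
  intro f hf
  have hf' := mem_faces.1 hf
  refine (integrableOn_const (C := area (a f.2.1 - a f.1) (a f.2.2 - a f.1) /
    cross (w f.2.1 - w f.1) (w f.2.2 - w f.1))
    (volume_openTriangle_lt_top (w f.1) (w f.2.1) (w f.2.2)).ne).congr_fun
    (fun q hq => (jacobian_eq_const hw hD hf' hq).symm)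
    (isOpen_openTriangle (cross_face_pos hw hf').ne').measurableSet

/-- The integral of the pull-back of `g dx ∧ dy` under the piecewise affine map is the sum of the
integrals over the triangles in `ℂ²` onto which the faces are mapped. -/
theorem setIntegral_mul_jacobian (hw : IsConvexCCW w) (hD : IsTriangulation w D) {g : ℂ × ℂ → ℂ}
    (hg : Measurable g) {C : ℝ} (hC : ∀ q, ‖g (plMap w D a q)‖ ≤ C) :
    ∫ q in convexPolygon w, g (plMap w D a q) * jacobian (plMap w D a) q =
      ∑ f ∈ faces D, (∫ p in stdTriangle, g (triMap (a f.1) (a f.2.1) (a f.2.2) p)) *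
        area (a f.2.1 - a f.1) (a f.2.2 - a f.1) := by
  have hint : IntegrableOn (fun q => g (plMap w D a q) * jacobian (plMap w D a) q)
      (convexPolygon w) :=
    (integrableOn_jacobian hw hD).bdd_mul
      (hg.comp (measurable_plMap hw hD)).aestronglyMeasurable (ae_of_all _ hC)
  have hO : ∀ f ∈ faces D, MeasurableSet (openTriangle (w f.1) (w f.2.1) (w f.2.2)) :=
    fun f hf => (isOpen_openTriangle (cross_face_pos hw (mem_faces.1 hf)).ne').measurableSet
  rw [← setIntegral_congr_set (ae_eq_polygon hw hD), integral_biUnion_finset _ hO]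
  · refine Finset.sum_congr rfl fun f hf => ?_
    have hf' := mem_faces.1 hf
    have hpos := cross_face_pos hw hf'
    have hc : (cross (w f.2.1 - w f.1) (w f.2.2 - w f.1) : ℂ) ≠ 0 := by exact_mod_cast hpos.ne'
    rw [setIntegral_congr_fun (hO f hf) (g := fun q => g (plMap w D a q) *
        (area (a f.2.1 - a f.1) (a f.2.2 - a f.1) / cross (w f.2.1 - w f.1) (w f.2.2 - w f.1)))
        (fun q hq => by simp only [jacobian_eq_const hw hD hf' hq]),
      integral_mul_const, setIntegral_openTriangle hpos.ne', abs_of_pos hpos,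
      setIntegral_congr_fun isOpen_stdTriangle.measurableSet
        (g := fun p => g (triMap (a f.1) (a f.2.1) (a f.2.2) p))
        (fun p hp => by simp only [plMap_triMap hw hD hf' hp]), Complex.real_smul]
    field_simp
  · intro f hf f' hf' hne
    exact disjoint_openTriangle hw hD (mem_faces.1 hf) (mem_faces.1 hf') hne
  · intro f hf
    refine hint.mono_set ?_
    exact (openTriangle_subset_convexHull _ _ _).trans convexHull_triple_subset

theorem polygonalMeasure_apply (hw : IsConvexCCW w) (hD : IsTriangulation w D) {B : Set (ℂ × ℂ)}
    (hB : MeasurableSet B) :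
    polygonalMeasure w D a B =
      ∑ f ∈ faces D, (∫ p in stdTriangle,
        B.indicator (fun _ => (1 : ℂ)) (triMap (a f.1) (a f.2.1) (a f.2.2) p)) *
          area (a f.2.1 - a f.1) (a f.2.2 - a f.1) := by
  have hF := measurable_plMap (a := a) hw hD
  rw [← setIntegral_mul_jacobian (C := 1) hw hD (measurable_const.indicator hB)]
  · rw [polygonalMeasure, VectorMeasure.map_apply _ hF hB,
      withDensityᵥ_apply (integrableOn_jacobian hw hD) (hF hB),
      ← MeasureTheory.integral_indicator (hF hB)]
    refine integral_congr_ae (ae_of_all _ fun q => ?_)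
    by_cases hq : plMap w D a q ∈ B <;> simp [indicator, hq]
  · intro q
    by_cases hq : plMap w D a q ∈ B <;> simp [hq]

theorem integrable_polygonalMeasure (hw : IsConvexCCW w) (hD : IsTriangulation w D)
    {h : ℂ × ℂ → ℂ} (hh : Continuous h) : (polygonalMeasure w D a).Integrable h := by
  have := isFiniteMeasure_variation_withDensity (integrableOn_jacobian (a := a) hw hD)
  obtain ⟨C, hC⟩ := exists_bound_comp_plMap (a := a) hw hD hh
  refine VectorMeasure.Integrable.map hh.aestronglyMeasurable ?_
  exact Integrable.of_bound (hh.measurable.comp (measurable_plMap hw hD)).aestronglyMeasurable C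
    (ae_of_all _ hC)

theorem integral_polygonalMeasure (hw : IsConvexCCW w) (hD : IsTriangulation w D)
    {h : ℂ × ℂ → ℂ} (hh : Continuous h) :
    ∫ᵛ p, h p ∂[ContinuousLinearMap.mul ℝ ℂ; polygonalMeasure w D a] =
      ∑ f ∈ faces D, (∫ p in stdTriangle, h (triMap (a f.1) (a f.2.1) (a f.2.2) p)) *
        area (a f.2.1 - a f.1) (a f.2.2 - a f.1) := by
  have := isFiniteMeasure_variation_withDensity (integrableOn_jacobian (a := a) hw hD)
  obtain ⟨C, hC⟩ := exists_bound_comp_plMap (a := a) hw hD hh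
  have hF := measurable_plMap (a := a) hw hD
  have hm : StronglyMeasurable (h ∘ plMap w D a) := (hh.measurable.comp hF).stronglyMeasurable
  rw [← setIntegral_mul_jacobian hw hD hh.measurable hC, polygonalMeasure,
    VectorMeasure.integral_map hF hh.aestronglyMeasurable
      (Integrable.of_bound hm.aestronglyMeasurable C (ae_of_all _ hC))]
  exact integral_withDensity_of_bounded (integrableOn_jacobian hw hD)
    (ContinuousLinearMap.mul ℝ ℂ) hm hC

end Sum

/-! ### The boundary of a triangulation -/

theorem isLinearMap_cross (u : ℂ) : IsLinearMap ℝ (cross u) where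
  map_add x y := by simp only [cross, Complex.add_re, Complex.add_im]; ring
  map_smul c x := by
    simp only [cross, Complex.real_smul, Complex.re_ofReal_mul, Complex.im_ofReal_mul, smul_eq_mul]
    ring

theorem cross_sub_right (u x y : ℂ) : cross u (x - y) = cross u x - cross u y := by
  simp only [cross, Complex.sub_re, Complex.sub_im]; ring

section Boundary

variable {n : ℕ} {w : Fin n → ℂ} {D : Set (Sym2 (Fin n))}

theorem val_finRotate (j : Fin n) :
    ((finRotate n j : Fin n) : ℕ) = if (j : ℕ) + 1 = n then 0 else (j : ℕ) + 1 := by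
  obtain _ | m := n
  · exact j.elim0
  · rw [finRotate_apply, Fin.val_add_one]
    simp only [Fin.ext_iff, Fin.val_last, Nat.add_right_cancel_iff]

theorem edge_symm {x y : Fin n} (h : IsSide x y ∨ s(x, y) ∈ D) : IsSide y x ∨ s(y, x) ∈ D := by
  rcases h with h | h
  · exact Or.inl h.symm
  · exact Or.inr (Sym2.eq_swap ▸ h)

/-- Any point close to the midpoint of an edge and on the same side as the vertex `w l` lies in a
face; in the limit this face contains the midpoint, hence it has the edge as one of its sides. -/
theorem exists_face_near_edge (hD : IsTriangulation w D) {p q : Fin n}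
    (l : Fin n) :
    ∃ i j k, IsFace D i j k ∧ (1 / 2 : ℝ) • w p + (1 / 2 : ℝ) • w q ∈ convexHull ℝ {w i, w j, w k} ∧
      ∃ ε : ℝ, 0 < ε ∧ (1 - ε) • ((1 / 2 : ℝ) • w p + (1 / 2 : ℝ) • w q) + ε • w l ∈
        convexHull ℝ {w i, w j, w k} := by
  set m : ℂ := (1 / 2 : ℝ) • w p + (1 / 2 : ℝ) • w q with hm
  have hv : ∀ i, w i ∈ convexPolygon w := fun i => subset_convexHull ℝ _ (mem_range_self i)
  have hconv : Convex ℝ (convexPolygon w) := convex_convexHull ℝ _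
  have hmP : m ∈ convexPolygon w := hconv (hv p) (hv q) (by norm_num) (by norm_num) (by norm_num)
  set z : ℝ → ℂ := fun ε => (1 - ε) • m + ε • w l with hz
  have hev : ∀ᶠ ε : ℝ in 𝓝[>] 0, z ε ∈ convexPolygon w := by
    filter_upwards [Ioo_mem_nhdsGT (zero_lt_one' ℝ)] with ε hε
    exact hconv hmP (hv l) (by linarith [hε.2]) hε.1.le (by ring)
  have hex : ∃ f : Fin n × Fin n × Fin n, ∃ᶠ ε : ℝ in 𝓝[>] 0, IsFace D f.1 f.2.1 f.2.2 ∧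
      z ε ∈ convexHull ℝ {w f.1, w f.2.1, w f.2.2} := by
    by_contra hcon
    simp only [not_exists, Filter.not_frequently] at hcon
    obtain ⟨ε, h1, h2⟩ := (hev.and (Filter.eventually_all.2 hcon)).exists
    obtain ⟨i, j, k, hf, hz⟩ := hD.cover _ h1
    exact h2 (i, j, k) ⟨hf, hz⟩
  obtain ⟨⟨i, j, k⟩, hfr⟩ := hex
  obtain ⟨ε, ⟨hf, hzε⟩, hε⟩ := (hfr.and_eventually self_mem_nhdsWithin).exists
  refine ⟨i, j, k, hf, ?_, ε, hε, hzε⟩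
  have ht : Filter.Tendsto z (𝓝[>] 0) (𝓝 m) := by
    have : Continuous z := by fun_prop
    have h := this.tendsto 0
    simp only [hz, sub_zero, one_smul, zero_smul, add_zero] at h
    exact h.mono_left nhdsWithin_le_nhds
  exact (isCompact_triangle _ _ _).isClosed.mem_of_frequently_of_tendsto
    (hfr.mono fun _ h => h.2) ht

/-- If there is a vertex `w l` on some side of the edge `(p, q)`, then a face of the triangulation
lies along the edge on that side. -/
theorem exists_face_beside (hw : IsConvexCCW w) (hD : IsTriangulation w D) {p q l : Fin n}
    (hpq : p < q) (he : IsSide p q ∨ s(p, q) ∈ D) :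
    ((p < l ∧ l < q) → ∃ j, IsFace D p j q) ∧
      ((l < p ∨ q < l) → ∃ r, IsFace D p q r ∨ IsFace D r p q) := by
  by_cases hl : (p < l ∧ l < q) ∨ (l < p ∨ q < l)
  swap
  · exact ⟨fun h => absurd (Or.inl h) hl, fun h => absurd (Or.inr h) hl⟩
  have hne : w p ≠ w q := by
    rcases hl with h | h | h
    · exact (vertex_ne hw h.1 h.2).2.2
    · exact (vertex_ne hw h hpq).2.1
    · exact (vertex_ne hw hpq h).1
  -- the face has the midpoint of the edge as a point, and barycentric coordinates in the two ways
  -- show that `p` and `q` are among its vertices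
  obtain ⟨i, j, k, hf, hm, ε, hε, hz⟩ := exists_face_near_edge hD (p := p) (q := q) l
  have hc := (cross_face_pos hw hf).ne'
  obtain ⟨h1, h2, h3⟩ := triCoord_mem_of_mem_convexHull hc hm
  have hmt := triMap_triCoord hc ((1 / 2 : ℝ) • w p + (1 / 2 : ℝ) • w q)
  set t := triCoord (w i) (w j) (w k) ((1 / 2 : ℝ) • w p + (1 / 2 : ℝ) • w q)
  rw [triMap_eq_sum] at hmt
  obtain ⟨d0, d1, dm, -⟩ := isBary_single (w := w) hf (α := 1 - t.re - t.im) (by linarith) h1 h2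
    (by ring)
  rw [hmt] at dm
  have ds : ∀ x, (Pi.single i (1 - t.re - t.im) + Pi.single j t.re + Pi.single k t.im :
      Fin n → ℝ) x ≠ 0 → x = i ∨ x = j ∨ x = k := by
    intro x hx
    by_contra hcon
    push Not at hcon
    simp [hcon.1, hcon.2.1, hcon.2.2] at hx
  set d : Fin n → ℝ := Pi.single i (1 - t.re - t.im) + Pi.single j t.re + Pi.single k t.im
  set c : Fin n → ℝ := Pi.single p (1 / 2) + Pi.single q (1 / 2) with hcdef
  have c0 : ∀ x, 0 ≤ c x := by
    intro x
    simp only [hcdef, Pi.add_apply, Pi.single_apply]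
    split_ifs <;> norm_num
  have c1 : ∑ x, c x = 1 := by
    simp [hcdef, Finset.sum_add_distrib]; norm_num
  have cm : ∑ x, c x • w x = (1 / 2 : ℝ) • w p + (1 / 2 : ℝ) • w q := by
    simp [hcdef, add_smul, Finset.sum_add_distrib, Pi.single_apply, ite_smul]
  have cs : ∀ x, x ≠ p → x ≠ q → c x = 0 := by
    intro x h1 h2
    simp [hcdef, h1, h2]
  obtain ⟨hij, hjk, eij, ejk, eik⟩ := hf
  have edge : ∀ x y, (x = i ∨ x = j ∨ x = k) → (y = i ∨ y = j ∨ y = k) → x ≠ y →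
      IsSide x y ∨ s(x, y) ∈ D := by
    rintro x y (rfl | rfl | rfl) (rfl | rfl | rfl) hxy <;>
      first
      | exact absurd rfl hxy
      | assumption
      | exact edge_symm (by assumption)
  -- edges do not cross, so all vertices of the face lie weakly on one side of the edge
  have hsep : (∀ x, (x = i ∨ x = j ∨ x = k) → ¬ (x < p ∨ q < x)) ∨
      (∀ x, (x = i ∨ x = j ∨ x = k) → ¬ (p < x ∧ x < q)) := by
    by_contra hcon
    push Not at hcon
    obtain ⟨⟨y, hy, hy'⟩, x, hx, hx'⟩ := hcon
    refine edge_between hw hD he (edge x y hx hy ?_) hx'.1 hx'.2 hy'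
    rintro rfl
    simp only [Fin.lt_def] at *
    omega
  have hcd : c = d := by
    rcases hsep with h | h
    · refine eq_of_separated hw hpq c0 d0 c1 d1 (cm.trans dm.symm)
        (fun x h1 h2 => cs x h1.ne' h2.ne) (fun x hx => ?_) hne
      by_contra hcon
      exact h x (ds x hcon) hx
    · refine (eq_of_separated hw hpq d0 c0 d1 c1 (dm.trans cm.symm) (fun x h1 h2 => ?_)
        (fun x hx => cs x ?_ ?_) hne).symm
      · by_contra hcon
        exact h x (ds x hcon) ⟨h1, h2⟩
      all_goals
        rintro rfl
        simp only [Fin.lt_def] at *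
        omega
  have hp : p = i ∨ p = j ∨ p = k := ds p (by rw [← hcd]; simp [hcdef, hpq.ne])
  have hq : q = i ∨ q = j ∨ q = k := ds q (by rw [← hcd]; simp [hcdef, hpq.ne'])
  -- the side of the edge is detected by the sign of an affine function vanishing on it
  have hσz : cross (w q - w p) ((1 - ε) • ((1 / 2 : ℝ) • w p + (1 / 2 : ℝ) • w q) + ε • w l) -
      cross (w q - w p) (w p) = ε * cross (w q - w p) (w l - w p) := by
    simp only [cross, Complex.sub_re, Complex.sub_im, Complex.add_re, Complex.add_im,
      Complex.real_smul, Complex.re_ofReal_mul, Complex.im_ofReal_mul]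
    ring
  have hσp : cross (w q - w p) (w p - w p) = 0 := by simp [cross]
  have hσq : cross (w q - w p) (w q - w p) = 0 := by simp only [cross]; ring
  rcases hsep with h | h
  · have hle : ∀ x, (x = i ∨ x = j ∨ x = k) →
        cross (w q - w p) (w x) ≤ cross (w q - w p) (w p) := by
      intro x hx
      rw [← sub_nonpos, ← cross_sub_right]
      have : x = p ∨ x = q ∨ (p < x ∧ x < q) := by
        have := h x hx; simp only [Fin.lt_def, Fin.ext_iff] at *; omega
      rcases this with rfl | rfl | h'
      · exact hσp.le
      · exact hσq.le
      · exact (cross_neg_of_between hw h'.1 h'.2).le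
    have hzle : (1 - ε) • ((1 / 2 : ℝ) • w p + (1 / 2 : ℝ) • w q) + ε • w l ∈
        {x | cross (w q - w p) x ≤ cross (w q - w p) (w p)} := by
      refine convexHull_min ?_ (convex_halfSpace_le (isLinearMap_cross _) _) hz
      rintro _ (rfl | rfl | rfl)
      exacts [hle i (by simp), hle j (by simp), hle k (by simp)]
    have hface : p = i ∧ q = k := by
      have := h i (by simp); have := h k (by simp); have := h j (by simp)
      simp only [Fin.lt_def, Fin.ext_iff] at *
      omega
    refine ⟨fun _ => ⟨j, ?_⟩, fun hout => absurd hzle ?_⟩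
    · rw [hface.1, hface.2]; exact ⟨hij, hjk, eij, ejk, eik⟩
    · have := mul_pos hε (cross_pos_of_outside hw hpq hout)
      simp only [mem_ofPred_eq, not_le]
      linarith
  · have hge : ∀ x, (x = i ∨ x = j ∨ x = k) →
        cross (w q - w p) (w p) ≤ cross (w q - w p) (w x) := by
      intro x hx
      rw [← sub_nonneg, ← cross_sub_right]
      have : x = p ∨ x = q ∨ (x < p ∨ q < x) := by
        have := h x hx; simp only [Fin.lt_def, Fin.ext_iff] at *; omega
      rcases this with rfl | rfl | h'
      · exact hσp.ge
      · exact hσq.ge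
      · exact (cross_pos_of_outside hw hpq h').le
    have hzge : (1 - ε) • ((1 / 2 : ℝ) • w p + (1 / 2 : ℝ) • w q) + ε • w l ∈
        {x | cross (w q - w p) (w p) ≤ cross (w q - w p) x} := by
      refine convexHull_min ?_ (convex_halfSpace_ge (isLinearMap_cross _) _) hz
      rintro _ (rfl | rfl | rfl)
      exacts [hge i (by simp), hge j (by simp), hge k (by simp)]
    have hface : (p = i ∧ q = j) ∨ (p = j ∧ q = k) := by
      have := h i (by simp); have := h k (by simp); have := h j (by simp)
      simp only [Fin.lt_def, Fin.ext_iff] at *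
      omega
    refine ⟨fun hin => absurd hzge ?_, fun _ => ?_⟩
    · have := mul_neg_of_pos_of_neg hε (cross_neg_of_between hw hin.1 hin.2)
      simp only [mem_ofPred_eq, not_le]
      linarith
    · rcases hface with ⟨e1, e2⟩ | ⟨e1, e2⟩
      · exact ⟨k, Or.inl (by rw [e1, e2]; exact ⟨hij, hjk, eij, ejk, eik⟩)⟩
      · exact ⟨i, Or.inr (by rw [e1, e2]; exact ⟨hij, hjk, eij, ejk, eik⟩)⟩

theorem face_inner_unique (hw : IsConvexCCW w) (hD : IsTriangulation w D) {p q j j' : Fin n}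
    (h : IsFace D p j q) (h' : IsFace D p j' q) : j = j' := by
  rcases lt_trichotomy j j' with hlt | rfl | hlt
  · exact (edge_between hw hD h'.2.2.1 h.2.2.2.1 h.1 hlt (Or.inr h'.2.1)).elim
  · rfl
  · exact (edge_between hw hD h.2.2.1 h'.2.2.2.1 h'.1 hlt (Or.inr h.2.1)).elim

theorem face_outer_unique (hw : IsConvexCCW w) (hD : IsTriangulation w D) {p q r r' : Fin n}
    (h : IsFace D p q r ∨ IsFace D r p q) (h' : IsFace D p q r' ∨ IsFace D r' p q) : r = r' := by
  have right : ∀ {x y}, IsFace D p q x → IsFace D p q y → ¬ x < y := fun hx hy hlt =>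
    edge_between hw hD hx.2.2.2.2 hy.2.2.2.1 hx.1 hx.2.1 (Or.inr hlt)
  have left : ∀ {x y}, IsFace D x p q → IsFace D y p q → ¬ x < y := fun hx hy hlt =>
    edge_between hw hD hx.2.2.1 hy.2.2.2.2 hlt hy.1 (Or.inr hx.2.1)
  have mixed : ∀ {x y}, IsFace D x p q → IsFace D p q y → False := fun hx hy =>
    edge_between hw hD hx.2.2.2.2 hy.2.2.2.2 hx.1 hx.2.1 (Or.inr hy.2.1)
  rcases h with h | h <;> rcases h' with h' | h'
  · exact le_antisymm (not_lt.1 (right h' h)) (not_lt.1 (right h h'))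
  · exact (mixed h' h).elim
  · exact (mixed h h').elim
  · exact le_antisymm (not_lt.1 (left h' h)) (not_lt.1 (left h h'))

end Boundary

section BoundarySum

variable {n : ℕ} {w : Fin n → ℂ} {D : Set (Sym2 (Fin n))}

theorem sum_ite_unique {ι : Type*} [Fintype ι] {P : ι → Prop} [DecidablePred P]
    [Decidable (∃ r, P r)] (hP : ∀ r r', P r → P r' → r = r') :
    ∑ r, (if P r then (1 : ℂ) else 0) = if ∃ r, P r then 1 else 0 := by
  split_ifs with h
  · obtain ⟨r, hr⟩ := h
    rw [Finset.sum_eq_single r (fun b _ hb => if_neg fun hb' => hb (hP b r hb' hr)) (by simp),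
      if_pos hr]
  · exact Finset.sum_eq_zero fun r _ => if_neg fun hr => h ⟨r, hr⟩

theorem exists_face_inner_iff (hw : IsConvexCCW w) (hD : IsTriangulation w D) {p q : Fin n}
    (hpq : p < q) :
    (∃ j, IsFace D p j q) ↔ (IsSide p q ∨ s(p, q) ∈ D) ∧ q ≠ finRotate n p := by
  have hr := val_finRotate p
  constructor
  · rintro ⟨j, h1, h2, -, -, h⟩
    refine ⟨h, fun hq => ?_⟩
    rw [← hq] at hr
    simp only [Fin.lt_def] at *
    split_ifs at hr <;> omega
  · rintro ⟨he, hq⟩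
    have hlt : (p : ℕ) + 1 < q := by
      rw [Ne, Fin.ext_iff, hr, if_neg (by have := q.isLt; simp only [Fin.lt_def] at hpq; omega)] at hq
      simp only [Fin.lt_def] at hpq
      omega
    exact (exists_face_beside hw hD (l := ⟨p + 1, hlt.trans q.isLt⟩) hpq he).1
      ⟨Nat.lt_succ_self _, hlt⟩

theorem exists_face_outer_iff (hw : IsConvexCCW w) (hD : IsTriangulation w D) {p q : Fin n}
    (hpq : p < q) :
    (∃ r, IsFace D p q r ∨ IsFace D r p q) ↔
      (IsSide p q ∨ s(p, q) ∈ D) ∧ p ≠ finRotate n q := by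
  have hr := val_finRotate q
  constructor
  · rintro ⟨r, h⟩
    refine ⟨?_, fun hp => ?_⟩
    · rcases h with h | h
      exacts [h.2.2.1, h.2.2.2.1]
    · rw [← hp] at hr
      have hr' := r.isLt
      have : r < p ∨ q < r := h.elim (fun h => Or.inr h.2.1) fun h => Or.inl h.1
      simp only [Fin.lt_def] at *
      split_ifs at hr <;> omega
  · rintro ⟨he, hp⟩
    rw [Ne, Fin.ext_iff, hr] at hp
    simp only [Fin.lt_def] at hpq
    by_cases hq : (q : ℕ) + 1 = n
    · rw [if_pos hq] at hp
      exact (exists_face_beside hw hD (l := ⟨0, by omega⟩) hpq he).2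
        (Or.inl (Nat.pos_of_ne_zero hp))
    · have := q.isLt
      exact (exists_face_beside hw hD (l := ⟨q + 1, by omega⟩) hpq he).2
        (Or.inr (Nat.lt_succ_self _))

open Classical in
/-- The multiplicity of the oriented edge `(p, q)`, `p < q`, in the sum of the boundaries of the
faces: a diagonal lies on two faces with opposite orientations, a side on one. -/
theorem edge_multiplicity (hn : 3 ≤ n) (hw : IsConvexCCW w) (hD : IsTriangulation w D)
    (p q : Fin n) :
    ((∑ r, if IsFace D p q r then (1 : ℂ) else 0) + ∑ r, if IsFace D r p q then (1 : ℂ) else 0) -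
        ∑ r, (if IsFace D p r q then (1 : ℂ) else 0) =
      (if p < q ∧ q = finRotate n p then 1 else 0) -
        if p < q ∧ p = finRotate n q then 1 else 0 := by
  by_cases hpq : p < q
  swap
  · have h1 : ∀ r, ¬ IsFace D p q r := fun r h => hpq h.1
    have h2 : ∀ r, ¬ IsFace D r p q := fun r h => hpq h.2.1
    have h3 : ∀ r, ¬ IsFace D p r q := fun r h => hpq (h.1.trans h.2.1)
    simp [h1, h2, h3, hpq]
  have hout : ((∑ r, if IsFace D p q r then (1 : ℂ) else 0) +
      ∑ r, if IsFace D r p q then (1 : ℂ) else 0) =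
        ∑ r, if IsFace D p q r ∨ IsFace D r p q then (1 : ℂ) else 0 := by
    rw [← Finset.sum_add_distrib]
    refine Finset.sum_congr rfl fun r _ => ?_
    by_cases h1 : IsFace D p q r <;> by_cases h2 : IsFace D r p q <;> simp [h1, h2]
    exact (h1.2.1.trans (h2.1.trans hpq)).false
  rw [hout, sum_ite_unique fun r r' => face_outer_unique hw hD,
    sum_ite_unique fun r r' => face_inner_unique hw hD]
  simp only [exists_face_inner_iff hw hD hpq, exists_face_outer_iff hw hD hpq, hpq, true_and]
  by_cases hs1 : q = finRotate n p
  · have hs2 : p ≠ finRotate n q := by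
      intro h
      have e1 := val_finRotate p
      have e2 := val_finRotate q
      rw [← hs1] at e1
      rw [← h] at e2
      split_ifs at e1 e2 <;> omega
    have : IsSide p q := Or.inl hs1
    rw [if_pos ⟨Or.inl this, hs2⟩, if_neg (fun h => h.2 hs1), if_pos hs1, if_neg hs2]
  · by_cases hs2 : p = finRotate n q
    · have : IsSide p q := Or.inr hs2
      rw [if_neg (fun h => h.2 hs2), if_pos ⟨Or.inl this, hs1⟩, if_neg hs1, if_pos hs2]
    · simp only [ne_eq, hs1, hs2, not_false_eq_true, and_true, if_false, sub_self]

/-- The boundaries of the faces of a triangulation add up to the boundary of the polygon. -/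
theorem sum_faces_boundary (hn : 3 ≤ n) (hw : IsConvexCCW w) (hD : IsTriangulation w D)
    {c : Fin n → Fin n → ℂ} (hc : ∀ i j, c j i = -c i j) :
    ∑ f ∈ faces D, (c f.1 f.2.1 + c f.2.1 f.2.2 + c f.2.2 f.1) = ∑ j, c j (finRotate n j) := by
  classical
  have hsum : ∑ f ∈ faces D, (c f.1 f.2.1 + c f.2.1 f.2.2 + c f.2.2 f.1) =
      ∑ p, ∑ q, c p q * (((∑ r, if IsFace D p q r then (1 : ℂ) else 0) +
        ∑ r, if IsFace D r p q then (1 : ℂ) else 0) -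
        ∑ r, (if IsFace D p r q then (1 : ℂ) else 0)) := by
    have hs : ∑ f ∈ faces D, (c f.1 f.2.1 + c f.2.1 f.2.2 + c f.2.2 f.1) =
        ∑ f ∈ faces D, (c f.1 f.2.1 + c f.2.1 f.2.2 - c f.1 f.2.2) :=
      Finset.sum_congr rfl fun f _ => by rw [hc f.1 f.2.2]; ring
    rw [hs, faces, Finset.sum_filter, Fintype.sum_prod_type]
    simp only [mul_sub, mul_add, Finset.mul_sum, Finset.sum_add_distrib, Finset.sum_sub_distrib]
    simp only [Fintype.sum_prod_type]
    have split : ∀ i j k, (if IsFace D i j k then c i j + c j k - c i k else 0) =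
        c i j * (if IsFace D i j k then 1 else 0) + c j k * (if IsFace D i j k then 1 else 0) -
          c i k * (if IsFace D i j k then 1 else 0) := by
      intro i j k
      split_ifs <;> ring
    simp only [split, Finset.sum_add_distrib, Finset.sum_sub_distrib]
    congr 1
    · congr 1
      rw [Finset.sum_comm]
      refine Finset.sum_congr rfl fun j _ => ?_
      rw [Finset.sum_comm]
    · refine Finset.sum_congr rfl fun i _ => ?_
      rw [Finset.sum_comm]
  rw [hsum]
  simp only [edge_multiplicity hn hw hD, mul_sub, Finset.sum_sub_distrib, mul_ite, mul_one, mul_zero]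
  rw [Finset.sum_comm (f := fun p q => if p < q ∧ p = finRotate n q then c p q else 0),
    ← Finset.sum_sub_distrib]
  refine Finset.sum_congr rfl fun j _ => ?_
  have e1 : ∑ q, (if j < q ∧ q = finRotate n j then c j q else 0) =
      if j < finRotate n j then c j (finRotate n j) else 0 := by
    rw [Finset.sum_eq_single (finRotate n j) (fun b _ hb => if_neg fun h => hb h.2) (by simp)]
    simp
  have e2 : ∑ p, (if p < j ∧ p = finRotate n j then c p j else 0) =
      if finRotate n j < j then c (finRotate n j) j else 0 := by
    rw [Finset.sum_eq_single (finRotate n j) (fun b _ hb => if_neg fun h => hb h.2) (by simp)]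
    simp
  rw [e1, e2]
  have hv := val_finRotate j
  rcases lt_trichotomy j (finRotate n j) with h | h | h
  · rw [if_pos h, if_neg h.asymm, sub_zero]
  · rw [← h] at hv
    split_ifs at hv <;> omega
  · rw [if_neg h.asymm, if_pos h, zero_sub, hc j, neg_neg]

end BoundarySum

/-! ### Stokes' theorem for a triangle -/

theorem setIntegral_stdTriangle_eq_prod (g : ℝ × ℝ → ℂ) :
    ∫ p in stdTriangle, g (p.re, p.im) =
      ∫ z in {z : ℝ × ℝ | 0 < z.1 ∧ 0 < z.2 ∧ z.1 + z.2 < 1}, g z :=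
  Complex.volume_preserving_equiv_real_prod.setIntegral_preimage_emb
    Complex.measurableEquivRealProd.measurableEmbedding g
    {z : ℝ × ℝ | 0 < z.1 ∧ 0 < z.2 ∧ z.1 + z.2 < 1}

theorem measurableSet_prodTriangle :
    MeasurableSet {z : ℝ × ℝ | 0 < z.1 ∧ 0 < z.2 ∧ z.1 + z.2 < 1} :=
  ((isOpen_lt continuous_const continuous_fst).inter
    ((isOpen_lt continuous_const continuous_snd).inter
      (isOpen_lt (continuous_fst.add continuous_snd) continuous_const))).measurableSet

theorem integrableOn_prodTriangle {g : ℝ × ℝ → ℂ} (hg : Continuous g) :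
    IntegrableOn g {z : ℝ × ℝ | 0 < z.1 ∧ 0 < z.2 ∧ z.1 + z.2 < 1} := by
  refine (hg.continuousOn.integrableOn_compact (isCompact_Icc (a := ((0 : ℝ), (0 : ℝ)))
    (b := (1, 1)))).mono_set ?_
  rintro ⟨x, y⟩ ⟨h1, h2, h3⟩
  simp only [mem_Icc, Prod.mk_le_mk] at *
  exact ⟨⟨h1.le, h2.le⟩, by linarith, by linarith⟩

/-- Fubini's theorem for the standard triangle. -/
theorem setIntegral_prodTriangle {g : ℝ × ℝ → ℂ} (hg : Continuous g) :
    ∫ z in {z : ℝ × ℝ | 0 < z.1 ∧ 0 < z.2 ∧ z.1 + z.2 < 1}, g z =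
      ∫ x in (0 : ℝ)..1, ∫ y in (0 : ℝ)..(1 - x), g (x, y) := by
  rw [← MeasureTheory.integral_indicator measurableSet_prodTriangle, Measure.volume_eq_prod,
    integral_prod _ ((integrable_indicator_iff measurableSet_prodTriangle).2
      (integrableOn_prodTriangle hg)),
    intervalIntegral.integral_of_le zero_le_one, integral_Ioc_eq_integral_Ioo,
    ← MeasureTheory.integral_indicator measurableSet_Ioo]
  congr 1
  funext x
  by_cases hx : x ∈ Ioo (0 : ℝ) 1
  · rw [indicator_of_mem hx, intervalIntegral.integral_of_le (by linarith [hx.2]),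
      integral_Ioc_eq_integral_Ioo, ← MeasureTheory.integral_indicator measurableSet_Ioo]
    congr 1
    funext y
    by_cases h : y ∈ Ioo 0 (1 - x)
    · rw [indicator_of_mem h, indicator_of_mem]
      exact ⟨hx.1, h.1, lt_sub_iff_add_lt'.1 h.2⟩
    · rw [indicator_of_notMem h, indicator_of_notMem]
      exact fun h' => h ⟨h'.2.1, lt_sub_iff_add_lt'.2 h'.2.2⟩
  · rw [indicator_of_notMem hx]
    refine integral_eq_zero_of_ae (ae_of_all _ fun y => indicator_of_notMem ?_ _)
    rintro ⟨h1, h2, h3⟩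
    simp only at h1 h2 h3
    exact hx ⟨h1, by linarith⟩

theorem setIntegral_prodTriangle_symm {g : ℝ × ℝ → ℂ} (hg : Continuous g) :
    ∫ z in {z : ℝ × ℝ | 0 < z.1 ∧ 0 < z.2 ∧ z.1 + z.2 < 1}, g z =
      ∫ y in (0 : ℝ)..1, ∫ x in (0 : ℝ)..(1 - y), g (x, y) := by
  rw [← setIntegral_prodTriangle (g := fun z => g (z.2, z.1)) (by fun_prop),
    ← MeasureTheory.integral_indicator measurableSet_prodTriangle,
    ← MeasureTheory.integral_indicator measurableSet_prodTriangle, Measure.volume_eq_prod,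
    ← integral_prod_swap]
  congr 1
  funext z
  by_cases h : 0 < z.1 ∧ 0 < z.2 ∧ z.1 + z.2 < 1
  · rw [indicator_of_mem (s := {z : ℝ × ℝ | 0 < z.1 ∧ 0 < z.2 ∧ z.1 + z.2 < 1}) h,
      indicator_of_mem]
    · rfl
    · exact ⟨h.2.1, h.1, (add_comm _ _).trans_lt h.2.2⟩
  · rw [indicator_of_notMem (s := {z : ℝ × ℝ | 0 < z.1 ∧ 0 < z.2 ∧ z.1 + z.2 < 1}) h,
      indicator_of_notMem]
    exact fun h' => h ⟨h'.2.1, h'.1, (add_comm _ _).trans_lt h'.2.2⟩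

theorem dForm_eq {ω : ℂ × ℂ → (ℂ × ℂ →L[ℝ] ℂ)} {p : ℂ × ℂ} (hω : DifferentiableAt ℝ ω p)
    (u v : ℂ × ℂ) : dForm ω p u v = fderiv ℝ ω p u v - fderiv ℝ ω p v u := by
  have hd : DifferentiableAt ℝ
      (fun x => ContinuousAlternatingMap.ofSubsingleton ℝ (ℂ × ℂ) ℂ (0 : Fin 1) (ω x)) p :=
    ((ContinuousAlternatingMap.ofSubsingletonLIE (𝕜 := ℝ) (E := ℂ × ℂ) (F := ℂ)
      (0 : Fin 1)).differentiable _).comp p hω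
  have e : ∀ x y : ℂ × ℂ, fderiv ℝ (fun z => ω z x) p y = fderiv ℝ ω p y x := by
    intro x y
    rw [fderiv_clm_apply hω (differentiableAt_const x)]
    simp
  rw [dForm, extDeriv_apply hd, Fin.sum_univ_two]
  simp [Fin.removeNth, e, sub_eq_add_neg]

/-- Stokes' theorem for the affine triangle in `ℂ²` with vertices `a`, `b`, `c`. -/
theorem integral_dForm_triangle {ω : ℂ × ℂ → (ℂ × ℂ →L[ℝ] ℂ)} (hω : ContDiff ℝ 1 ω)
    (a b c : ℂ × ℂ) :
    ∫ p in stdTriangle, dForm ω (triMap a b c p) (b - a) (c - a) =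
      curveIntegral ω (Path.segment a b) + curveIntegral ω (Path.segment b c) +
        curveIntegral ω (Path.segment c a) := by
  set u := b - a with hu
  set v := c - a with hv
  set G : ℝ × ℝ → ℂ × ℂ := fun z => a + (z.1 • u + z.2 • v) with hG
  have hGc : Continuous G := by fun_prop
  have hd : Differentiable ℝ ω := hω.differentiable one_ne_zero
  have hω' : Continuous (fderiv ℝ ω) := hω.continuous_fderiv one_ne_zero
  have hωG (x : ℂ × ℂ) : Continuous fun z => ω (G z) x :=
    (hω.continuous.comp hGc).clm_apply continuous_const
  have hdG (x y : ℂ × ℂ) : Continuous fun z => fderiv ℝ ω (G z) x y :=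
    ((hω'.comp hGc).clm_apply continuous_const).clm_apply continuous_const
  have hs (x : ℂ × ℂ) (t s : ℝ) :
      HasDerivAt (fun s => ω (G (s, t)) x) (fderiv ℝ ω (G (s, t)) u x) s := by
    have h1 : HasDerivAt (fun s : ℝ => G (s, t)) u s := by
      simpa [hG] using (((hasDerivAt_id s).smul_const u).add_const (t • v)).const_add a
    have h2 := (hd (G (s, t))).hasFDerivAt.comp_hasDerivAt s h1
    exact ((ContinuousLinearMap.apply ℝ ℂ x).hasFDerivAt.comp_hasDerivAt s h2)
  have ht (x : ℂ × ℂ) (s t : ℝ) :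
      HasDerivAt (fun t => ω (G (s, t)) x) (fderiv ℝ ω (G (s, t)) v x) t := by
    have h1 : HasDerivAt (fun t : ℝ => G (s, t)) v t := by
      simpa [hG] using (((hasDerivAt_id t).smul_const v).const_add (s • u)).const_add a
    have h2 := (hd (G (s, t))).hasFDerivAt.comp_hasDerivAt t h1
    exact ((ContinuousLinearMap.apply ℝ ℂ x).hasFDerivAt.comp_hasDerivAt t h2)
  have e1 : ∫ p in stdTriangle, dForm ω (triMap a b c p) u v =
      ∫ p in stdTriangle, (fun z => fderiv ℝ ω (G z) u v - fderiv ℝ ω (G z) v u) (p.re, p.im) := by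
    refine setIntegral_congr_fun isOpen_stdTriangle.measurableSet fun p _ => ?_
    simp only [dForm_eq (hd _)]
    rfl
  have e2 : ∫ y in (0 : ℝ)..1, ∫ x in (0 : ℝ)..(1 - y), fderiv ℝ ω (G (x, y)) u v =
      ∫ y in (0 : ℝ)..1, (ω (G (1 - y, y)) v - ω (G (0, y)) v) := by
    congr 1
    funext y
    exact intervalIntegral.integral_eq_sub_of_hasDerivAt (fun s _ => hs v y s)
      (Continuous.intervalIntegrable ((hdG u v).comp (by fun_prop)) _ _)
  have e3 : ∫ x in (0 : ℝ)..1, ∫ y in (0 : ℝ)..(1 - x), fderiv ℝ ω (G (x, y)) v u =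
      ∫ x in (0 : ℝ)..1, (ω (G (x, 1 - x)) u - ω (G (x, 0)) u) := by
    congr 1
    funext x
    exact intervalIntegral.integral_eq_sub_of_hasDerivAt (fun t _ => ht u x t)
      (Continuous.intervalIntegrable ((hdG v u).comp (by fun_prop)) _ _)
  have e4 : ∫ x in (0 : ℝ)..1, ω (G (x, 1 - x)) u = ∫ y in (0 : ℝ)..1, ω (G (1 - y, y)) u := by
    have := intervalIntegral.integral_comp_sub_left (a := 0) (b := 1)
      (fun x : ℝ => ω (G (x, 1 - x)) u) 1
    simpa using this.symm
  have ii {f : ℝ → ℂ} (hf : Continuous f) : IntervalIntegrable f volume 0 1 :=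
    hf.intervalIntegrable _ _
  have c1 (x : ℂ × ℂ) : Continuous fun y : ℝ => ω (G (1 - y, y)) x := (hωG x).comp (by fun_prop)
  have c2 (x : ℂ × ℂ) : Continuous fun y : ℝ => ω (G (0, y)) x := (hωG x).comp (by fun_prop)
  have c3 (x : ℂ × ℂ) : Continuous fun y : ℝ => ω (G (y, 0)) x := (hωG x).comp (by fun_prop)
  have c4 (x : ℂ × ℂ) : Continuous fun y : ℝ => ω (G (y, 1 - y)) x := (hωG x).comp (by fun_prop)
  rw [e1, setIntegral_stdTriangle_eq_prod
      (fun z => fderiv ℝ ω (G z) u v - fderiv ℝ ω (G z) v u),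
    integral_sub (integrableOn_prodTriangle (hdG u v)) (integrableOn_prodTriangle (hdG v u)),
    setIntegral_prodTriangle_symm (hdG u v), setIntegral_prodTriangle (hdG v u), e2, e3,
    intervalIntegral.integral_sub (ii (c1 v)) (ii (c2 v)),
    intervalIntegral.integral_sub (ii (c4 u)) (ii (c3 u)), e4,
    ← Path.segment_symm a c, curveIntegral_symm, curveIntegral_segment, curveIntegral_segment,
    curveIntegral_segment]
  have f1 : ∫ t in (0 : ℝ)..1, ω (AffineMap.lineMap a b t) (b - a) =
      ∫ x in (0 : ℝ)..1, ω (G (x, 0)) u := by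
    congr 1; funext t
    simp [hG, AffineMap.lineMap_apply, hu, add_comm]
  have f2 : ∫ t in (0 : ℝ)..1, ω (AffineMap.lineMap a c t) (c - a) =
      ∫ y in (0 : ℝ)..1, ω (G (0, y)) v := by
    congr 1; funext t
    simp [hG, AffineMap.lineMap_apply, hv, add_comm]
  have f3 : ∫ t in (0 : ℝ)..1, ω (AffineMap.lineMap b c t) (c - b) =
      (∫ y in (0 : ℝ)..1, ω (G (1 - y, y)) v) - ∫ y in (0 : ℝ)..1, ω (G (1 - y, y)) u := by
    rw [← intervalIntegral.integral_sub (ii (c1 v)) (ii (c1 u))]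
    congr 1; funext t
    have h1 : AffineMap.lineMap b c t = G (1 - t, t) := by
      simp only [hG, AffineMap.lineMap_apply, hu, hv, vsub_eq_sub, vadd_eq_add]
      module
    rw [h1, ← map_sub, hu, hv, sub_sub_sub_cancel_right]
  rw [f1, f2, f3]
  ring

/-! ### Holomorphic functions on `ℂ²` and primitives of `h dx ∧ dy` -/

/-- A complex differentiable function of several variables is continuously differentiable, because
Cauchy's formula expresses its directional derivatives by integrals of its values. -/
theorem contDiff_one_of_differentiable {E : Type*} [NormedAddCommGroup E] [NormedSpace ℂ E]
    [FiniteDimensional ℂ E] {f : E → ℂ} (hf : Differentiable ℂ f) : ContDiff ℂ 1 f := by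
  refine contDiff_one_iff_fderiv.2 ⟨hf, continuous_clm_apply.2 fun v => ?_⟩
  have hline (x : E) : Differentiable ℂ fun z : ℂ => f (x + z • v) := by fun_prop
  have key : ∀ x, fderiv ℂ f x v =
      (2 * Real.pi * Complex.I)⁻¹ • ∮ z in C(0, 1), (1 / (z - 0) ^ 2) • f (x + z • v) := by
    intro x
    rw [(hline x).diffContOnCl.deriv_eq_smul_circleIntegral one_pos, smul_smul,
      inv_mul_cancel₀ Complex.two_pi_I_ne_zero, one_smul]
    have h1 : HasDerivAt (fun z : ℂ => x + z • v) v 0 := by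
      simpa using ((hasDerivAt_id (0 : ℂ)).smul_const v).const_add x
    have h2 : HasFDerivAt f (fderiv ℂ f x) (x + (0 : ℂ) • v) := by
      simpa using (hf x).hasFDerivAt
    exact (h2.comp_hasDerivAt (0 : ℂ) h1).deriv.symm
  simp only [key]
  suffices hcont : Continuous fun x => ∮ z in C(0, 1), (1 / (z - 0) ^ 2) • f (x + z • v) by
    fun_prop
  unfold circleIntegral
  refine intervalIntegral.continuous_parametric_intervalIntegral_of_continuous' ?_ _ _
  simp only [deriv_circleMap, sub_zero]
  have hc : Continuous fun p : E × ℝ => circleMap 0 1 p.2 := by fun_prop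
  have hfc := hf.continuous
  have h0 : ∀ p : E × ℝ, circleMap 0 1 p.2 ^ 2 ≠ 0 := fun p =>
    pow_ne_zero 2 (circleMap_ne_center one_ne_zero)
  exact (by fun_prop : Continuous fun p : E × ℝ => circleMap 0 1 p.2 * Complex.I).smul
    ((continuous_const.div (hc.pow 2) h0).smul (by fun_prop))

/-- A holomorphic function `h` has a holomorphic primitive in the first variable,
namely `H (x, y) = x ∫₀¹ h (t x, y) dt`. -/
theorem exists_hasFDerivAt_fst_eq {h : ℂ × ℂ → ℂ} (hh : Differentiable ℂ h) :
    ∃ H : ℂ × ℂ → ℂ, Differentiable ℂ H ∧ ∀ p, fderiv ℂ H p (1, 0) = h p := by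
  have h1 := contDiff_one_of_differentiable hh
  have hc' : Continuous (fderiv ℂ h) := h1.continuous_fderiv one_ne_zero
  have hc := hh.continuous
  set A : ℝ → ℂ × ℂ →L[ℂ] ℂ × ℂ := fun t =>
    ((t : ℂ) • ContinuousLinearMap.fst ℂ ℂ ℂ).prod (ContinuousLinearMap.snd ℂ ℂ ℂ) with hA
  have hA' : ∀ t p, A t p = ((t : ℂ) * p.1, p.2) := by intro t p; simp [hA]
  have hAc : Continuous A := by
    rw [continuous_clm_apply]
    intro p
    simp only [hA']
    fun_prop
  have hAj : Continuous fun z : (ℂ × ℂ) × ℝ => A z.2 z.1 := by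
    simp only [hA']
    fun_prop
  set k' : ℂ × ℂ → ℝ → ℂ × ℂ →L[ℂ] ℂ := fun p t => (fderiv ℂ h (A t p)).comp (A t) with hk'
  have hk'c : Continuous fun z : (ℂ × ℂ) × ℝ => k' z.1 z.2 :=
    (hc'.comp hAj).clm_comp (hAc.comp continuous_snd)
  have hk : ∀ p, HasFDerivAt (fun p => ∫ t in (0 : ℝ)..1, h (A t p))
      (∫ t in (0 : ℝ)..1, k' p t) p := by
    intro p
    obtain ⟨C, hC⟩ := ((isCompact_closedBall p 1).prod
      (isCompact_Icc (a := (0 : ℝ)) (b := 1))).exists_bound_of_continuousOn hk'c.continuousOn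
    refine intervalIntegral.hasFDerivAt_integral_of_dominated_of_fderiv_le
      (F := fun p t => h (A t p)) (F' := k') (bound := fun _ => C)
      (Metric.closedBall_mem_nhds p one_pos) ?_ ?_ ?_ ?_ ?_ ?_
    · refine Filter.Eventually.of_forall fun x => Continuous.aestronglyMeasurable ?_
      exact hc.comp (hAj.comp (Continuous.prodMk_right x))
    · exact (hc.comp (hAj.comp (Continuous.prodMk_right p))).intervalIntegrable
        _ _
    · exact (hk'c.comp (Continuous.prodMk_right p)).aestronglyMeasurable
    · refine ae_of_all _ fun t ht x hx => hC (x, t) ⟨hx, ?_⟩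
      rw [uIoc_of_le zero_le_one] at ht
      exact Ioc_subset_Icc_self ht
    · exact intervalIntegrable_const
    · exact ae_of_all _ fun t _ x _ => (hh (A t x)).hasFDerivAt.comp x (A t).hasFDerivAt
  have hH : ∀ p : ℂ × ℂ, HasFDerivAt (fun p : ℂ × ℂ => p.1 * ∫ t in (0 : ℝ)..1, h (A t p)) _ p :=
    fun p => hasFDerivAt_fst.mul (hk p)
  refine ⟨_, fun p => (hH p).differentiableAt, fun p => ?_⟩
  rw [(hH p).fderiv]
  have hcp : Continuous fun t : ℝ => k' p t := hk'c.comp (Continuous.prodMk_right p)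
  have hcq : Continuous fun t : ℝ => h (A t p) := hc.comp (hAj.comp (Continuous.prodMk_right p))
  have e1 : (∫ t in (0 : ℝ)..1, k' p t) (1, 0) = ∫ t in (0 : ℝ)..1, k' p t (1, 0) :=
    ContinuousLinearMap.intervalIntegral_apply (hcp.intervalIntegrable _ _) _
  have hcr : Continuous fun t : ℝ => k' p t (1, 0) := hcp.clm_apply continuous_const
  have hcm : Continuous fun t : ℝ => p.1 * k' p t (1, 0) := continuous_const.mul hcr
  have e2 : ∫ t in (0 : ℝ)..1, (p.1 * k' p t (1, 0) + h (A t p)) = h p := by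
    have hd : ∀ t : ℝ, HasDerivAt (fun t : ℝ => (t : ℂ) * h (A t p))
        (p.1 * k' p t (1, 0) + h (A t p)) t := by
      intro t
      have d1 : HasDerivAt (fun t : ℝ => A t p) (p.1, 0) t := by
        simp only [hA']
        refine HasDerivAt.prodMk ?_ (hasDerivAt_const t p.2)
        simpa using (Complex.ofRealCLM.hasDerivAt (x := t)).mul_const p.1
      have d2 := ((hh (A t p)).hasFDerivAt.restrictScalars ℝ).comp_hasDerivAt t d1
      have d3 := (Complex.ofRealCLM.hasDerivAt (x := t)).mul d2
      refine d3.congr_deriv ?_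
      have e : fderiv ℂ h (A t p) (p.1, 0) = p.1 * fderiv ℂ h (A t p) (1, 0) := by
        rw [← smul_eq_mul, ← map_smul]; simp
      have e' : k' p t (1, 0) = t * fderiv ℂ h (A t p) (1, 0) := by
        rw [← smul_eq_mul (t : ℂ), ← map_smul]; simp [hk', hA']
      simp only [Complex.ofRealCLM_apply, ContinuousLinearMap.coe_restrictScalars', Function.comp_apply, e, e',
        Complex.ofReal_one]
      ring
    rw [intervalIntegral.integral_eq_sub_of_hasDerivAt (fun t _ => hd t)
      ((hcm.add hcq).intervalIntegrable _ _)]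
    simp [hA']
  rw [intervalIntegral.integral_add (hcm.intervalIntegrable _ _)
    (hcq.intervalIntegrable _ _), intervalIntegral.integral_const_mul] at e2
  rw [← e2, ← e1]
  simp

theorem half_I_mul_dzdzbar (u v : ℂ × ℂ) : Complex.I / 2 * dzdzbar u v = area u v := by
  simp only [dzdzbar, area]
  linear_combination (u.2 * v.1 - u.1 * v.2) * Complex.I_sq

/-- The form `H dy`, where `∂H/∂x = h`, is a primitive of `h dx ∧ dy`: since `H` is holomorphic, its
differential is a combination of `dx` and `dy`, without conjugate terms. -/
theorem exists_primitive {h : ℂ × ℂ → ℂ} (hh : Differentiable ℂ h) :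
    ∃ ω : ℂ × ℂ → (ℂ × ℂ →L[ℝ] ℂ), ContDiff ℝ 1 ω ∧
      ∀ p u v : ℂ × ℂ, dForm ω p u v = Complex.I / 2 * h p * dzdzbar u v := by
  obtain ⟨H, hH, hH'⟩ := exists_hasFDerivAt_fst_eq hh
  have hd : ∀ p, HasFDerivAt (fun p => H p • ContinuousLinearMap.snd ℝ ℂ ℂ)
      (((fderiv ℂ H p).restrictScalars ℝ).smulRight (ContinuousLinearMap.snd ℝ ℂ ℂ)) p :=
    fun p => ((hH p).hasFDerivAt.restrictScalars ℝ).smul_const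
      (ContinuousLinearMap.snd ℝ ℂ ℂ)
  refine ⟨fun p => H p • ContinuousLinearMap.snd ℝ ℂ ℂ,
    ((contDiff_one_of_differentiable hH).restrict_scalars ℝ).smul contDiff_const, fun p u v => ?_⟩
  have lin : ∀ x : ℂ × ℂ, fderiv ℂ H p x = x.1 * h p + x.2 * fderiv ℂ H p (0, 1) := by
    intro x
    rw [← hH' p, ← smul_eq_mul, ← smul_eq_mul, ← map_smul, ← map_smul, ← map_add]
    simp
  rw [dForm_eq (hd p).differentiableAt, (hd p).fderiv,
    show Complex.I / 2 * h p * dzdzbar u v = h p * (Complex.I / 2 * dzdzbar u v) by ring,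
    half_I_mul_dzdzbar]
  simp only [ContinuousLinearMap.smulRight_apply, ContinuousLinearMap.coe_restrictScalars',
    _root_.smul_apply, ContinuousLinearMap.coe_snd', smul_eq_mul, area]
  rw [lin u, lin v]
  ring

variable {n : ℕ} {w : Fin n → ℂ} {D : Set (Sym2 (Fin n))} {a : Fin n → ℂ × ℂ}

theorem integral_eq_closedPolygonIntegral (hn : 3 ≤ n) (hw : IsConvexCCW w)
    (hD : IsTriangulation w D) {h : ℂ × ℂ → ℂ} (hh : Continuous h)
    {ω : ℂ × ℂ → (ℂ × ℂ →L[ℝ] ℂ)} (hω : ContDiff ℝ 1 ω)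
    (hdω : ∀ p u v : ℂ × ℂ, dForm ω p u v = Complex.I / 2 * h p * dzdzbar u v) :
    ∫ᵛ p, h p ∂[ContinuousLinearMap.mul ℝ ℂ; polygonalMeasure w D a] =
      closedPolygonIntegral a ω := by
  rw [integral_polygonalMeasure hw hD hh, closedPolygonIntegral,
    ← sum_faces_boundary hn hw hD (c := fun i j => curveIntegral ω (Path.segment (a i) (a j)))
      fun i j => by rw [← Path.segment_symm (a i) (a j), curveIntegral_symm]]
  refine Finset.sum_congr rfl fun f _ => ?_
  rw [← integral_dForm_triangle hω, ← integral_mul_const]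
  refine integral_congr_ae (ae_of_all _ fun p => ?_)
  simp only [hdω, ← half_I_mul_dzdzbar]
  ring

/-! ### Winding numbers of polygons and triangles -/

/-- The 1-form `dz / (z - q)`. -/
noncomputable def cauchyForm (q z : ℂ) : ℂ →L[ℂ] ℂ := (z - q)⁻¹ • ContinuousLinearMap.id ℂ ℂ

theorem div_mem_slitPlane {q x y : ℂ} (h : q ∉ segment ℝ x y) :
    (y - q) / (x - q) ∈ Complex.slitPlane := by
  have hx : x - q ≠ 0 := sub_ne_zero.2 fun e => h (e ▸ left_mem_segment ℝ x y)
  rw [Complex.mem_slitPlane_iff_not_le_zero]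
  intro hle
  set r := (y - q) / (x - q) with hr
  rw [Complex.le_def] at hle
  simp only [Complex.zero_re, Complex.zero_im] at hle
  have hy : y - q = (r.re : ℂ) * (x - q) := by
    rw [show (r.re : ℂ) = r from Complex.ext rfl (by simp [hle.2]), hr, div_mul_cancel₀ _ hx]
  have hpos : 0 < 1 - r.re := by linarith [hle.1]
  have hpos' : (1 - r.re : ℂ) ≠ 0 := by exact_mod_cast hpos.ne'
  refine h ⟨-r.re / (1 - r.re), 1 / (1 - r.re), div_nonneg (by linarith [hle.1]) hpos.le,
    by positivity, by field_simp; ring, ?_⟩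
  simp only [Complex.real_smul]
  push_cast
  field_simp
  linear_combination hy

/-- Along a segment that misses `q` the principal logarithm is a primitive of `dz / (z - q)`. -/
theorem curveIntegral_cauchyForm {q x y : ℂ} (h : q ∉ segment ℝ x y) :
    curveIntegral (cauchyForm q) (Path.segment x y) = Complex.log ((y - q) / (x - q)) := by
  have hx : x - q ≠ 0 := sub_ne_zero.2 fun e => h (e ▸ left_mem_segment ℝ x y)
  have hmem : ∀ t ∈ Icc (0 : ℝ) 1, AffineMap.lineMap x y t ∈ segment ℝ x y := by
    intro t ht
    rw [segment_eq_image_lineMap]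
    exact mem_image_of_mem _ ht
  have hslit : ∀ t ∈ Icc (0 : ℝ) 1,
      (AffineMap.lineMap x y t - q) / (x - q) ∈ Complex.slitPlane := fun t ht =>
    div_mem_slitPlane fun hq => h ((convex_segment x y).segment_subset (left_mem_segment ℝ x y)
      (hmem t ht) hq)
  have hne : ∀ t ∈ Icc (0 : ℝ) 1, AffineMap.lineMap x y t - q ≠ 0 := fun t ht =>
    sub_ne_zero.2 fun e => h (e ▸ hmem t ht)
  have hd : ∀ t ∈ Icc (0 : ℝ) 1, HasDerivAt
      (fun t : ℝ => Complex.log ((AffineMap.lineMap x y t - q) / (x - q)))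
      ((AffineMap.lineMap x y t - q)⁻¹ * (y - x)) t := by
    intro t ht
    have h1 : HasDerivAt (fun t : ℝ => (AffineMap.lineMap x y t - q) / (x - q))
        ((y - x) / (x - q)) t :=
      (AffineMap.hasDerivAt_lineMap.sub_const q).div_const (x - q)
    refine (h1.clog_real (hslit t ht)).congr_deriv ?_
    have := hne t ht
    field_simp
  rw [curveIntegral_segment]
  have e : ∀ t : ℝ, cauchyForm q (AffineMap.lineMap x y t) (y - x) =
      (AffineMap.lineMap x y t - q)⁻¹ * (y - x) := fun t => by simp [cauchyForm]
  simp only [e]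
  rw [intervalIntegral.integral_eq_sub_of_hasDerivAt
    (f := fun t : ℝ => Complex.log ((AffineMap.lineMap x y t - q) / (x - q)))]
  · simp [div_self hx]
  · intro t ht
    rw [uIcc_of_le zero_le_one] at ht
    exact hd t ht
  · refine ContinuousOn.intervalIntegrable ?_
    rw [uIcc_of_le zero_le_one]
    refine ContinuousOn.mul (ContinuousOn.inv₀ ?_ hne) continuousOn_const
    exact (AffineMap.lineMap_continuous.sub continuous_const).continuousOn

theorem windingNumber_eq {n : ℕ} (b : Fin n → ℂ) (q : ℂ) :
    windingNumber b q = (2 * Real.pi * Complex.I)⁻¹ *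
      ∑ j, curveIntegral (cauchyForm q) (Path.segment (b j) (b (finRotate n j))) := rfl

theorem im_div_eq_cross (u v : ℂ) : (v / u).im = cross u v / Complex.normSq u := by
  rw [Complex.div_im, cross]; ring

/-- The winding number of the boundary of a triangle, off the sides: `1` or `-1`, according to the
orientation, inside the triangle and `0` outside. -/
noncomputable def triIndex (x y z q : ℂ) : ℝ :=
  (openTriangle x y z).indicator (fun _ => (SignType.sign (cross (y - x) (z - x)) : ℝ)) q

/-- The winding number is an integer, and the three angles at which `q` sees the sides, which lie in
`(-π, π)` and have the signs of the three determinants, decide which one it is. -/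
theorem sum_log_triangle {x y z q : ℂ} (hxy : q ∉ segment ℝ x y) (hyz : q ∉ segment ℝ y z)
    (hzx : q ∉ segment ℝ z x) :
    Complex.log ((y - q) / (x - q)) + Complex.log ((z - q) / (y - q)) +
      Complex.log ((x - q) / (z - q)) = 2 * Real.pi * Complex.I * triIndex x y z q := by
  have hx : x - q ≠ 0 := sub_ne_zero.2 fun e => hxy (e ▸ left_mem_segment ℝ x y)
  have hy : y - q ≠ 0 := sub_ne_zero.2 fun e => hyz (e ▸ left_mem_segment ℝ y z)
  have hz : z - q ≠ 0 := sub_ne_zero.2 fun e => hzx (e ▸ left_mem_segment ℝ z x)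
  set L := Complex.log ((y - q) / (x - q)) + Complex.log ((z - q) / (y - q)) +
      Complex.log ((x - q) / (z - q)) with hL
  have hexp : Complex.exp L = 1 := by
    rw [hL, Complex.exp_add, Complex.exp_add, Complex.exp_log (div_ne_zero hy hx),
      Complex.exp_log (div_ne_zero hz hy), Complex.exp_log (div_ne_zero hx hz)]
    field_simp
  -- the sum of the three angles is `2πm` for an integer `m`
  obtain ⟨m, hm⟩ := Complex.exp_eq_one_iff.1 hexp
  have him : ((y - q) / (x - q)).arg + ((z - q) / (y - q)).arg + ((x - q) / (z - q)).arg =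
      m * (2 * Real.pi) := by
    have h1 : L.im = ((y - q) / (x - q)).arg + ((z - q) / (y - q)).arg +
        ((x - q) / (z - q)).arg := by simp [hL, Complex.log_im]
    rw [← h1, hm]
    simp
  have hsign : ∀ {u v : ℂ}, u ≠ 0 → v / u ∈ Complex.slitPlane →
      -Real.pi < (v / u).arg ∧ (v / u).arg < Real.pi ∧ (0 < (v / u).arg ↔ 0 < cross u v) ∧
        ((v / u).arg < 0 ↔ cross u v < 0) := by
    intro u v hu hs
    have hn : 0 < Complex.normSq u := Complex.normSq_pos.2 hu
    have hneg : (v / u).arg < 0 ↔ cross u v < 0 := by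
      rw [Complex.arg_neg_iff, im_div_eq_cross, div_neg_iff]
      constructor
      · rintro (h | h)
        exacts [absurd h.2 hn.asymm, h.1]
      · exact fun h => Or.inr ⟨h, hn⟩
    refine ⟨Complex.neg_pi_lt_arg _,
      lt_of_le_of_ne (Complex.arg_le_pi _) (Complex.mem_slitPlane_iff_arg.1 hs).1, ?_, hneg⟩
    have hzero : (v / u).arg = 0 ↔ cross u v = 0 := by
      rw [Complex.arg_eq_zero_iff, im_div_eq_cross, div_eq_zero_iff]
      refine ⟨fun h => h.2.resolve_right hn.ne', fun h => ⟨?_, Or.inl h⟩⟩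
      rcases hs with h' | h'
      · exact h'.le
      · rw [im_div_eq_cross, h, zero_div] at h'
        exact absurd rfl h'
    constructor
    · intro h
      exact lt_of_le_of_ne (not_lt.1 fun h' => h.asymm (hneg.2 h')) fun h' => h.ne' (hzero.2 h'.symm)
    · intro h
      exact lt_of_le_of_ne (not_lt.1 fun h' => h.asymm (hneg.1 h')) fun h' => h.ne' (hzero.1 h'.symm)
  obtain ⟨l1, u1, p1, n1⟩ := hsign hx (div_mem_slitPlane hxy)
  obtain ⟨l2, u2, p2, n2⟩ := hsign hy (div_mem_slitPlane hyz)
  obtain ⟨l3, u3, p3, n3⟩ := hsign hz (div_mem_slitPlane hzx)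
  have hsum : cross (x - q) (y - q) + cross (y - q) (z - q) + cross (z - q) (x - q) =
      cross (y - x) (z - x) := by
    simp only [cross, Complex.sub_re, Complex.sub_im]; ring
  have hs1 : cross (y - x) (q - x) = cross (x - q) (y - q) := by
    simp only [cross, Complex.sub_re, Complex.sub_im]; ring
  have hs3 : cross (q - x) (z - x) = cross (z - q) (x - q) := by
    simp only [cross, Complex.sub_re, Complex.sub_im]; ring
  -- barycentric coordinates of `q` as quotients of determinants
  have hmem : cross (y - x) (z - x) ≠ 0 → (q ∈ openTriangle x y z ↔
      0 < cross (z - q) (x - q) / cross (y - x) (z - x) ∧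
        0 < cross (x - q) (y - q) / cross (y - x) (z - x) ∧
          0 < cross (y - q) (z - q) / cross (y - x) (z - x)) := by
    intro hC
    rw [openTriangle_eq_preimage hC]
    have : cross (y - q) (z - q) / cross (y - x) (z - x) = 1 -
        (cross (z - q) (x - q) / cross (y - x) (z - x) +
          cross (x - q) (y - q) / cross (y - x) (z - x)) := by
      rw [← hsum] at hC ⊢
      field_simp
      ring
    rw [this, sub_pos, ← hs1, ← hs3]
    rfl
  have hpi := Real.pi_pos
  set α := ((y - q) / (x - q)).arg
  set β := ((z - q) / (y - q)).arg
  set γ := ((x - q) / (z - q)).arg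
  set c₁ := cross (x - q) (y - q)
  set c₂ := cross (y - q) (z - q)
  set c₃ := cross (z - q) (x - q)
  set C := cross (y - x) (z - x) with hC
  have fin : ∀ k : ℤ, (k - 1) * (2 * Real.pi) < α + β + γ → α + β + γ < (k + 1) * (2 * Real.pi) →
      m = k := by
    intro k h1 h2
    rw [him] at h1 h2
    have h1' := lt_of_mul_lt_mul_right h1 (by positivity)
    have h2' := lt_of_mul_lt_mul_right h2 (by positivity)
    have h3 : k - 1 < m := by exact_mod_cast h1'
    have h4 : m < k + 1 := by exact_mod_cast h2'
    omega
  suffices hfin : (m : ℝ) = triIndex x y z q by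
    rw [hm, ← hfin]; push_cast; ring
  by_cases hp : 0 < c₁ ∧ 0 < c₂ ∧ 0 < c₃
  · obtain ⟨h1, h2, h3⟩ := hp
    have hCpos : 0 < C := by rw [← hsum]; positivity
    have a1 := p1.2 h1; have a2 := p2.2 h2; have a3 := p3.2 h3
    rw [fin 1 (by push_cast; linarith) (by push_cast; linarith), triIndex, indicator_of_mem
      ((hmem hCpos.ne').2 ⟨by positivity, by positivity, by positivity⟩), sign_pos hCpos]
    simp
  by_cases hn : c₁ < 0 ∧ c₂ < 0 ∧ c₃ < 0
  · obtain ⟨h1, h2, h3⟩ := hn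
    have hCneg : C < 0 := by rw [← hsum]; linarith
    have a1 := n1.2 h1; have a2 := n2.2 h2; have a3 := n3.2 h3
    rw [fin (-1) (by push_cast; linarith) (by push_cast; linarith), triIndex, indicator_of_mem
      ((hmem hCneg.ne).2 ⟨div_pos_of_neg_of_neg h3 hCneg, div_pos_of_neg_of_neg h1 hCneg,
        div_pos_of_neg_of_neg h2 hCneg⟩), sign_neg hCneg]
    simp
  · have hzero : triIndex x y z q = 0 := by
      rw [triIndex, indicator_apply_eq_zero]
      intro hq
      rcases lt_trichotomy C 0 with h | h | h
      · obtain ⟨b3, b1, b2⟩ := (hmem h.ne).1 hq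
        have hneg : ∀ {c : ℝ}, 0 < c / C → c < 0 := fun hc =>
          not_le.1 fun h' => hc.not_ge (div_nonpos_of_nonneg_of_nonpos h' h.le)
        exact absurd ⟨hneg b1, hneg b2,
          hneg b3⟩ hn
      · rw [← hC, h]; simp
      · obtain ⟨b3, b1, b2⟩ := (hmem h.ne').1 hq
        exact absurd ⟨(div_pos_iff_of_pos_right h).1 b1, (div_pos_iff_of_pos_right h).1 b2,
          (div_pos_iff_of_pos_right h).1 b3⟩ hp
    -- not all three angles are positive and not all are negative, so `|α + β + γ| < 2π`
    have hup : α + β + γ < 2 * Real.pi := by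
      have : α ≤ 0 ∨ β ≤ 0 ∨ γ ≤ 0 := by
        by_contra hcon
        push Not at hcon
        exact hp ⟨p1.1 hcon.1, p2.1 hcon.2.1, p3.1 hcon.2.2⟩
      rcases this with h | h | h <;> linarith
    have hlo : -(2 * Real.pi) < α + β + γ := by
      have : 0 ≤ α ∨ 0 ≤ β ∨ 0 ≤ γ := by
        by_contra hcon
        push Not at hcon
        exact hn ⟨n1.1 hcon.1, n2.1 hcon.2.1, n3.1 hcon.2.2⟩
      rcases this with h | h | h <;> linarith
    rw [hzero, fin 0 (by push_cast; linarith) (by push_cast; linarith)]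
    simp

theorem volume_segment (x y : ℂ) : volume (segment ℝ x y) = 0 := by
  refine measure_mono_null (t := (line[ℝ, x, y] : Set ℂ)) ?_
    (Measure.addHaar_affineSubspace volume _ fun htop => ?_)
  · rw [← convexHull_pair]
    exact convexHull_subset_affineSpan _
  · have h1 := (collinear_pair ℝ x y).finrank_le_one
    rw [← direction_affineSpan, htop, AffineSubspace.direction_top, finrank_top,
      Complex.finrank_real_complex] at h1
    omega

section Real

variable {n : ℕ} {w : Fin n → ℂ} {D : Set (Sym2 (Fin n))} {b : Fin n → ℂ}

theorem windingNumber_eq_sum_triIndex (hn : 3 ≤ n) (hw : IsConvexCCW w) (hD : IsTriangulation w D)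
    {q : ℂ} (hq : ∀ i j, q ∉ segment ℝ (b i) (b j)) :
    windingNumber b q = ∑ f ∈ faces D, (triIndex (b f.1) (b f.2.1) (b f.2.2) q : ℂ) := by
  rw [windingNumber_eq, ← sum_faces_boundary hn hw hD
    (c := fun i j => curveIntegral (cauchyForm q) (Path.segment (b i) (b j)))
    fun i j => by rw [← Path.segment_symm (b i) (b j), curveIntegral_symm],
    Finset.mul_sum]
  refine Finset.sum_congr rfl fun f _ => ?_
  rw [curveIntegral_cauchyForm (hq _ _), curveIntegral_cauchyForm (hq _ _),
    curveIntegral_cauchyForm (hq _ _), sum_log_triangle (hq _ _) (hq _ _) (hq _ _),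
    inv_mul_cancel_left₀ Complex.two_pi_I_ne_zero]

theorem ae_windingNumber_eq (hn : 3 ≤ n) (hw : IsConvexCCW w) (hD : IsTriangulation w D) :
    windingNumber b =ᵐ[volume] fun q =>
      ∑ f ∈ faces D, (triIndex (b f.1) (b f.2.1) (b f.2.2) q : ℂ) := by
  have h : ∀ᵐ q : ℂ, ∀ i j, q ∉ segment ℝ (b i) (b j) :=
    ae_all_iff.2 fun i => ae_all_iff.2 fun j => measure_eq_zero_iff_ae_notMem.1 (volume_segment _ _)
  filter_upwards [h] with q hq using windingNumber_eq_sum_triIndex hn hw hD hq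

theorem integrable_triIndex (x y z : ℂ) : Integrable fun q => (triIndex x y z q : ℂ) := by
  suffices h : Integrable (triIndex x y z) from h.ofReal
  by_cases hC : cross (y - x) (z - x) = 0
  · have : triIndex x y z = fun _ => 0 := by
      funext q; simp [triIndex, hC]
    rw [this]
    exact integrable_zero _ _ _
  · exact (integrable_indicator_iff (isOpen_openTriangle hC).measurableSet).2
      (integrableOn_const (volume_openTriangle_lt_top x y z).ne)

theorem integrable_windingNumber (hn : 3 ≤ n) (hw : IsConvexCCW w) (hD : IsTriangulation w D) :
    Integrable (windingNumber b) volume :=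
  (integrable_finsetSum _ fun _ _ => integrable_triIndex _ _ _).congr
    (ae_windingNumber_eq hn hw hD).symm

theorem realPoint_triMap (x y z p : ℂ) :
    realPoint (triMap x y z p) = triMap (realPoint x) (realPoint y) (realPoint z) p := by
  simp only [realPoint, triMap]
  ext <;> simp

theorem area_realPoint (x y z : ℂ) :
    area (realPoint y - realPoint x) (realPoint z - realPoint x) = cross (y - x) (z - x) := by
  simp [area, realPoint, cross]
  ring

theorem measurableEmbedding_realPoint : MeasurableEmbedding realPoint := by
  have hc : Continuous realPoint := by unfold realPoint; fun_prop
  have hinv : Continuous fun p : ℂ × ℂ => Complex.equivRealProdCLM.symm (p.1.re, p.2.re) :=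
    Complex.equivRealProdCLM.symm.continuous.comp (by fun_prop)
  refine (Function.LeftInverse.isClosedEmbedding (fun q => ?_) hinv hc).measurableEmbedding
  apply Complex.ext <;> simp [realPoint]

theorem setIntegral_triIndex {B : Set (ℂ × ℂ)} (hB : MeasurableSet B) (x y z : ℂ) :
    (∫ p in stdTriangle, B.indicator (fun _ => (1 : ℂ))
        (triMap (realPoint x) (realPoint y) (realPoint z) p)) *
        area (realPoint y - realPoint x) (realPoint z - realPoint x) =
      ∫ q in realPoint ⁻¹' B, (triIndex x y z q : ℂ) := by
  have hB' := measurableEmbedding_realPoint.measurable hB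
  rw [area_realPoint]
  by_cases hC : cross (y - x) (z - x) = 0
  · simp [triIndex, hC]
  have hO := (isOpen_openTriangle hC).measurableSet
  have h1 := setIntegral_openTriangle hC fun q => B.indicator (fun _ => (1 : ℂ)) (realPoint q)
  simp only [realPoint_triMap] at h1
  have h2 : ∫ q in realPoint ⁻¹' B, (triIndex x y z q : ℂ) =
      (SignType.sign (cross (y - x) (z - x)) : ℝ) *
        ∫ q in openTriangle x y z, B.indicator (fun _ => (1 : ℂ)) (realPoint q) := by
    rw [← integral_const_mul, ← MeasureTheory.integral_indicator hB',
      ← MeasureTheory.integral_indicator hO]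
    congr 1
    funext q
    by_cases hq : q ∈ openTriangle x y z <;> by_cases hqB : realPoint q ∈ B <;>
      simp [triIndex, hq, hqB, indicator]
  rw [h2, h1, Complex.real_smul, ← mul_assoc, ← Complex.ofReal_mul, sign_mul_abs, mul_comm]

/-- For real vertices the polygonal measure has the winding number as its density. -/
theorem polygonalMeasure_real (hn : 3 ≤ n) (hw : IsConvexCCW w) (hD : IsTriangulation w D)
    {B : Set (ℂ × ℂ)} (hB : MeasurableSet B) :
    polygonalMeasure w D (fun j => realPoint (b j)) B =
      ∫ q in realPoint ⁻¹' B, windingNumber b q := by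
  rw [polygonalMeasure_apply hw hD hB,
    integral_congr_ae (ae_restrict_of_ae (ae_windingNumber_eq hn hw hD)),
    integral_finsetSum _ fun f _ => (integrable_triIndex _ _ _).integrableOn]
  exact Finset.sum_congr rfl fun f _ => setIntegral_triIndex hB _ _ _

theorem polygonalMeasure_real_eq_zero (hw : IsConvexCCW w) (hD : IsTriangulation w D)
    {B : Set (ℂ × ℂ)} (hB : MeasurableSet B)
    (hd : Disjoint B (realPoint '' convexHull ℝ (range b))) :
    polygonalMeasure w D (fun j => realPoint (b j)) B = 0 := by
  rw [polygonalMeasure_apply hw hD hB]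
  refine Finset.sum_eq_zero fun f _ => mul_eq_zero_of_left ?_ _
  refine setIntegral_eq_zero_of_forall_eq_zero fun p hp => indicator_of_notMem (fun hpB => ?_) _
  refine Set.disjoint_left.1 hd hpB ?_
  rw [← realPoint_triMap]
  exact mem_image_of_mem _ (convexHull_triple_subset (triMap_mem_convexHull _ _ _ hp))

end Real

/-! ### Winding numbers off the curve and simple polygons -/

/-- A convergent integer-valued function is eventually constant. -/
theorem exists_int_eventually_eq {X : Type*} {l : Filter X} {f : X → ℂ} {c : ℂ}
    (hf : Filter.Tendsto f l (𝓝 c)) (hint : ∀ᶠ q in l, ∃ k : ℤ, f q = k) :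
    ∃ k : ℤ, ∀ᶠ q in l, f q = k := by
  rcases l.eq_or_neBot with rfl | hl
  · exact ⟨0, Filter.eventually_bot⟩
  have hev := hint.and (hf.eventually (Metric.ball_mem_nhds c (by norm_num : (0 : ℝ) < 1 / 2)))
  obtain ⟨q₀, ⟨k₀, h₀⟩, hd₀⟩ := hev.exists
  refine ⟨k₀, hev.mono ?_⟩
  rintro q ⟨⟨k, hk⟩, hd⟩
  have h1 : dist (f q) (f q₀) < 1 := by
    linarith [dist_triangle_right (f q) (f q₀) c]
  rw [hk, h₀, dist_eq_norm, ← Int.cast_sub, Complex.norm_intCast] at h1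
  have h2 : |k - k₀| < 1 := by exact_mod_cast h1
  rw [hk, sub_eq_zero.1 (Int.abs_lt_one_iff.1 h2)]

theorem inter_frontier_nonempty {X : Type*} [TopologicalSpace X] {S P : Set X}
    (hS : IsPreconnected S) (h1 : (S ∩ P).Nonempty) (h2 : (S ∩ Pᶜ).Nonempty) :
    (S ∩ frontier P).Nonempty := by
  by_contra hcon
  have hout : ∀ x ∈ S, x ∈ closure P → x ∈ interior P := fun x hx hc => by
    by_contra hi
    exact hcon ⟨x, hx, hc, hi⟩
  obtain ⟨x, -, hx, hx'⟩ := hS (interior P) (closure P)ᶜ isOpen_interior isClosed_closure.isOpen_compl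
    (fun x hx => (em (x ∈ closure P)).imp (hout x hx) id)
    (h1.imp fun x hx => ⟨hx.1, hout x hx.1 (subset_closure hx.2)⟩)
    (h2.imp fun x hx => ⟨hx.1, fun hc => hx.2 (interior_subset (hout x hx.1 hc))⟩)
  exact hx' (interior_subset_closure hx)

section Curve

variable {n : ℕ} {b : Fin n → ℂ}

theorem isClosed_closedPolygon (b : Fin n → ℂ) : IsClosed (closedPolygon b) :=
  isClosed_iUnion_of_finite fun j => by
    rw [← convexHull_pair]
    exact ((finite_singleton _).insert _).isCompact_convexHull (𝕜 := ℝ) |>.isClosed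

theorem notMem_segment {q : ℂ} (hq : q ∉ closedPolygon b) (j : Fin n) :
    q ∉ segment ℝ (b j) (b (finRotate n j)) := fun h => hq (mem_iUnion.2 ⟨j, h⟩)

theorem vertex_mem_closedPolygon (j : Fin n) : b j ∈ closedPolygon b :=
  mem_iUnion.2 ⟨j, left_mem_segment ℝ _ _⟩

theorem volume_closedPolygon (b : Fin n → ℂ) : volume (closedPolygon b) = 0 :=
  measure_iUnion_null fun _ => volume_segment _ _

theorem windingNumber_eq_sum_log {q : ℂ} (hq : q ∉ closedPolygon b) :
    windingNumber b q = (2 * Real.pi * Complex.I)⁻¹ *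
      ∑ j, Complex.log ((b (finRotate n j) - q) / (b j - q)) := by
  rw [windingNumber_eq]
  congr 1
  exact Finset.sum_congr rfl fun j _ => curveIntegral_cauchyForm (notMem_segment hq j)

theorem exists_int_windingNumber {q : ℂ} (hq : q ∉ closedPolygon b) :
    ∃ k : ℤ, windingNumber b q = k := by
  have hne : ∀ j, b j - q ≠ 0 := fun j =>
    sub_ne_zero.2 fun h => hq (h ▸ vertex_mem_closedPolygon j)
  have hexp : Complex.exp (∑ j, Complex.log ((b (finRotate n j) - q) / (b j - q))) = 1 := by
    rw [Complex.exp_sum, Finset.prod_congr rfl fun j _ =>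
      Complex.exp_log (div_ne_zero (hne (finRotate n j)) (hne j)), Finset.prod_div_distrib,
      Equiv.prod_comp (finRotate n) fun j => b j - q]
    exact div_self (Finset.prod_ne_zero_iff.2 fun j _ => hne j)
  obtain ⟨k, hk⟩ := Complex.exp_eq_one_iff.1 hexp
  refine ⟨k, ?_⟩
  rw [windingNumber_eq_sum_log hq, hk, mul_comm, mul_assoc, mul_inv_cancel₀ Complex.two_pi_I_ne_zero,
    mul_one]

theorem continuousAt_log_div {x y q : ℂ} (h : q ∉ segment ℝ x y) :
    ContinuousAt (fun q => Complex.log ((y - q) / (x - q))) q := by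
  have hx : x - q ≠ 0 := sub_ne_zero.2 fun e => h (e ▸ left_mem_segment ℝ x y)
  exact ((continuousAt_const.sub continuousAt_id).div (continuousAt_const.sub continuousAt_id)
    hx).clog (div_mem_slitPlane h)

theorem eventually_notMem_closedPolygon {q : ℂ} (hq : q ∉ closedPolygon b) :
    ∀ᶠ q' in 𝓝 q, q' ∉ closedPolygon b :=
  (isClosed_closedPolygon b).isOpen_compl.mem_nhds hq

/-- The winding number is locally constant off the curve. -/
theorem eventually_windingNumber_eq {q : ℂ} (hq : q ∉ closedPolygon b) :
    ∀ᶠ q' in 𝓝 q, windingNumber b q' = windingNumber b q := by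
  have hc : ContinuousAt (windingNumber b) q := by
    have h1 : ContinuousAt (fun q => (2 * Real.pi * Complex.I)⁻¹ *
        ∑ j, Complex.log ((b (finRotate n j) - q) / (b j - q))) q :=
      continuousAt_const.mul (tendsto_finsetSum _ fun j _ =>
        continuousAt_log_div (notMem_segment hq j))
    refine h1.congr ?_
    filter_upwards [eventually_notMem_closedPolygon hq] with q' hq'
    exact (windingNumber_eq_sum_log hq').symm
  obtain ⟨k, hk⟩ := exists_int_eventually_eq hc
    ((eventually_notMem_closedPolygon hq).mono fun _ => exists_int_windingNumber)
  filter_upwards [hk] with q' hq'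
  rw [hq', hk.self_of_nhds]

theorem cross_side (x y q : ℂ) :
    cross (x - q) (y - q) = cross (y - x) q - cross (y - x) x := by
  simp only [cross, Complex.sub_re, Complex.sub_im]; ring

theorem log_of_im_pos {r : ℂ} (h : 0 < r.im) :
    Complex.log r = Complex.log (-r) + Real.pi * Complex.I := by
  apply Complex.ext
  · simp [Complex.log_re]
  · simp [Complex.log_im, Complex.arg_neg_eq_arg_sub_pi_of_im_pos h]

theorem log_of_im_neg {r : ℂ} (h : r.im < 0) :
    Complex.log r = Complex.log (-r) - Real.pi * Complex.I := by
  apply Complex.ext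
  · simp [Complex.log_re]
  · simp [Complex.log_im, Complex.arg_neg_eq_arg_add_pi_of_im_neg h]

namespace IsCCWPolygon

variable {P : Set ℂ}

/-- Near an interior point of a side, the polygon consists of the points to the left of the side
and of the points of the side. -/
theorem eventually_mem_iff (hP : IsCCWPolygon b P) {m : ℂ} {j : Fin n}
    (hm : m ∈ segment ℝ (b j) (b (finRotate n j))) (hv : m ∉ range b) :
    (∀ k, k ≠ j → m ∉ segment ℝ (b k) (b (finRotate n k))) ∧
      ((b (finRotate n j) - m) / (b j - m)).re < 0 ∧
    ∀ᶠ q in 𝓝[(closedPolygon b)ᶜ] m,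
      (0 < cross (b j - q) (b (finRotate n j) - q) ∧ q ∈ P) ∨
        (cross (b j - q) (b (finRotate n j) - q) < 0 ∧ q ∉ P) := by
  set A := b j with hA
  set B := b (finRotate n j) with hB
  have hmA : m ≠ A := fun h => hv ⟨j, h.symm⟩
  have hmB : m ≠ B := fun h => hv ⟨_, h.symm⟩
  have hmΓ : m ∈ closedPolygon b := mem_iUnion.2 ⟨j, hm⟩
  have hm' := hm
  rw [segment_eq_image_lineMap] at hm'
  obtain ⟨t, ⟨ht0, ht1⟩, htm⟩ := hm'
  have ht0' : 0 < t := ht0.lt_of_ne fun h => hmA (by rw [← htm, ← h, AffineMap.lineMap_apply_zero])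
  have ht1' : t < 1 := ht1.lt_of_ne fun h => hmB (by rw [← htm, h, AffineMap.lineMap_apply_one])
  have hAB : B - A ≠ 0 := by
    intro h
    rw [sub_eq_zero.1 h, AffineMap.lineMap_same_apply] at htm
    exact hmA htm.symm
  have hmeq : m = A + t * (B - A) := by
    rw [← htm, AffineMap.lineMap_apply]; simp [add_comm]
  -- the other sides stay away from `m`
  have hother : ∀ k, k ≠ j → m ∉ segment ℝ (b k) (b (finRotate n k)) := by
    intro k hk hmk
    rw [segment_eq_image_lineMap] at hmk
    obtain ⟨s, ⟨hs0, hs1⟩, hsm⟩ := hmk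
    rcases hs1.eq_or_lt with rfl | hs1
    · rw [AffineMap.lineMap_apply_one] at hsm
      exact hv ⟨_, hsm⟩
    · exact hk (hP.simple j k t ⟨ht0, ht1'⟩ s ⟨hs0, hs1⟩ (htm.trans hsm.symm)).1.symm
  have hr : (B - m) / (A - m) = ((-((1 - t) / t) : ℝ) : ℂ) := by
    have h1 : A - m ≠ 0 := sub_ne_zero.2 hmA.symm
    have h2 : (t : ℂ) ≠ 0 := by exact_mod_cast ht0'.ne'
    rw [div_eq_iff h1, hmeq]
    push_cast
    field_simp
    ring
  have hre : ((B - m) / (A - m)).re < 0 := by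
    rw [hr, Complex.ofReal_re, neg_lt_zero]
    exact div_pos (by linarith) ht0'
  refine ⟨hother, hre, ?_⟩
  -- a small disc `N` that meets no other side and meets the line `A B` inside the side
  have hev : ∀ᶠ q in 𝓝 m, (∀ k, k ≠ j → q ∉ segment ℝ (b k) (b (finRotate n k))) ∧
      ((B - q) / (A - q)).re < 0 ∧ q ≠ A := by
    refine Filter.Eventually.and (Filter.eventually_all.2 fun k => ?_) (Filter.Eventually.and ?_ ?_)
    · by_cases hk : k = j
      · exact Filter.Eventually.of_forall fun q h => absurd hk h
      · have hcl : IsClosed (segment ℝ (b k) (b (finRotate n k))) := by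
          rw [← convexHull_pair]
          exact ((finite_singleton _).insert _).isCompact_convexHull (𝕜 := ℝ) |>.isClosed
        filter_upwards [hcl.isOpen_compl.mem_nhds (hother k hk)] with q hq _ using hq
    · have hc : ContinuousAt (fun q => ((B - q) / (A - q)).re) m :=
        Complex.continuous_re.continuousAt.comp ((continuousAt_const.sub continuousAt_id).div
          (continuousAt_const.sub continuousAt_id) (sub_ne_zero.2 hmA.symm))
      exact hc.eventually_lt continuousAt_const hre
    · exact isOpen_ne.mem_nhds hmA
  obtain ⟨ε, hε, hN⟩ := Metric.eventually_nhds_iff_ball.1 hev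
  have hPcl := hP.isCompact.isClosed
  have hΓP : closedPolygon b ⊆ P := hP.frontier_eq ▸ hPcl.frontier_subset
  have him : ∀ q, q ≠ A → (((B - q) / (A - q)).im = 0 ↔ cross (A - q) (B - q) = 0) := by
    intro q hq
    rw [im_div_eq_cross, div_eq_zero_iff, Complex.normSq_eq_zero, sub_eq_zero]
    exact ⟨fun h => h.resolve_right fun h => hq h.symm, Or.inl⟩
  have hNΓ : ∀ q ∈ Metric.ball m ε, cross (A - q) (B - q) ≠ 0 → q ∉ closedPolygon b := by
    intro q hq hc hqΓ
    obtain ⟨k, hk⟩ := mem_iUnion.1 hqΓ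
    by_cases hkj : k = j
    · subst hkj
      obtain ⟨u, v, -, -, huv, rfl⟩ := hk
      apply hc
      rw [← eq_sub_iff_add_eq] at huv
      subst huv
      simp only [cross, ← hA, ← hB, Complex.sub_re, Complex.sub_im, Complex.add_re, Complex.add_im,
        Complex.real_smul, Complex.re_ofReal_mul, Complex.im_ofReal_mul]
      ring
    · exact (hN q hq).1 k hkj hk
  have hcross : ∀ q ∈ Metric.ball m ε, q ∉ closedPolygon b → cross (A - q) (B - q) ≠ 0 := by
    intro q hq hqΓ hc
    rcases div_mem_slitPlane (notMem_segment hqΓ j) with h | h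
    · exact h.asymm (hN q hq).2.1
    · exact h ((him q (hN q hq).2.2).2 hc)
  -- each open half-disc avoids the boundary of `P`, so it lies in `P` if it meets `P`
  have half : ∀ S : Set ℂ, Convex ℝ S → S ⊆ Metric.ball m ε →
      (∀ q ∈ S, cross (A - q) (B - q) ≠ 0) → (S ∩ P).Nonempty → S ⊆ P := by
    intro S hS hSN hSc hne
    by_contra hcon
    obtain ⟨z, hz, hz'⟩ := not_subset.1 hcon
    obtain ⟨y, hy, hy'⟩ := inter_frontier_nonempty hS.isPreconnected hne ⟨z, hz, hz'⟩
    rw [hP.frontier_eq] at hy'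
    exact hNΓ y (hSN hy) (hSc y hy) hy'
  have hpos : ∀ q ∈ Metric.ball m ε, 0 < cross (A - q) (B - q) → q ∈ P := by
    have hsub := half (Metric.ball m ε ∩ {q | cross (B - A) A < cross (B - A) q})
      ((convex_ball _ _).inter (convex_halfSpace_gt (isLinearMap_cross _) _)) inter_subset_left
      (fun q hq => by rw [cross_side]; exact (sub_pos.2 hq.2).ne') ?_
    · exact fun q hq hc => hsub ⟨hq, by rwa [cross_side, sub_pos] at hc⟩
    · have hleft := hP.left j t ⟨ht0', ht1'⟩
      rw [← hA, ← hB, htm] at hleft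
      have hball : ∀ᶠ δ : ℝ in 𝓝[>] 0, m + δ • (Complex.I * (B - A)) ∈ Metric.ball m ε := by
        have hc : Continuous fun δ : ℝ => m + δ • (Complex.I * (B - A)) := by fun_prop
        have h := hc.tendsto 0
        simp only [zero_smul, add_zero] at h
        exact (h.mono_left nhdsWithin_le_nhds).eventually (Metric.ball_mem_nhds m hε)
      obtain ⟨δ, ⟨h1, h2⟩, h3⟩ := ((hleft.and hball).and self_mem_nhdsWithin).exists
      refine ⟨_, ⟨h2, ?_⟩, h1⟩
      have h4 : cross (B - A) (m + δ • (Complex.I * (B - A))) - cross (B - A) A =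
          δ * Complex.normSq (B - A) := by
        rw [hmeq, Complex.normSq_apply]
        simp [cross]
        ring
      have h5 := mul_pos (show (0 : ℝ) < δ from h3) (Complex.normSq_pos.2 hAB)
      rw [mem_ofPred_eq, ← sub_pos, h4]
      exact h5
  have hneg : ∀ q ∈ Metric.ball m ε, cross (A - q) (B - q) < 0 → q ∉ P := by
    intro q₀ hq₀ hc₀ hq₀P
    have hsub := half (Metric.ball m ε ∩ {q | cross (B - A) q < cross (B - A) A})
      ((convex_ball _ _).inter (convex_halfSpace_lt (isLinearMap_cross _) _)) inter_subset_left
      (fun q hq => by rw [cross_side]; exact (sub_neg.2 hq.2).ne)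
      ⟨q₀, ⟨hq₀, by rwa [cross_side, sub_neg] at hc₀⟩, hq₀P⟩
    -- then the whole disc would be in `P`, but its centre is on the boundary
    have hball : Metric.ball m ε ⊆ P := by
      intro q hq
      by_cases hqΓ : q ∈ closedPolygon b
      · exact hΓP hqΓ
      · rcases (hcross q hq hqΓ).lt_or_gt with h | h
        · exact hsub ⟨hq, by rwa [cross_side, sub_neg] at h⟩
        · exact hpos q hq h
    rw [← hP.frontier_eq] at hmΓ
    exact hmΓ.2 (mem_interior.2 ⟨_, hball, Metric.isOpen_ball, Metric.mem_ball_self hε⟩)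
  filter_upwards [nhdsWithin_le_nhds (Metric.ball_mem_nhds m hε), self_mem_nhdsWithin] with q hq hqΓ
  rcases (hcross q hq hqΓ).lt_or_gt with h | h
  · exact Or.inr ⟨h, hneg q hq h⟩
  · exact Or.inl ⟨h, hpos q hq h⟩

/-- The difference of the winding number and the indicator function of `P`. -/
noncomputable def defect (b : Fin n → ℂ) (P : Set ℂ) (q : ℂ) : ℂ :=
  windingNumber b q - P.indicator 1 q

theorem exists_int_defect (P : Set ℂ) {q : ℂ} (hq : q ∉ closedPolygon b) :
    ∃ k : ℤ, defect b P q = k := by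
  obtain ⟨k, hk⟩ := exists_int_windingNumber hq
  by_cases hqP : q ∈ P
  · exact ⟨k - 1, by simp [defect, hk, hqP]⟩
  · exact ⟨k, by simp [defect, hk, hqP]⟩

/-- Both the winding number and the indicator function of `P` jump by one across a side, so their
difference is locally constant away from the vertices. -/
theorem exists_eventually_defect_eq (hP : IsCCWPolygon b P) {m : ℂ} (hv : m ∉ range b) :
    ∃ k : ℤ, ∀ᶠ q in 𝓝[(closedPolygon b)ᶜ] m, defect b P q = k := by
  have hint : ∀ᶠ q in 𝓝[(closedPolygon b)ᶜ] m, ∃ k : ℤ, defect b P q = k :=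
    Filter.mem_of_superset self_mem_nhdsWithin fun q hq => exists_int_defect P hq
  by_cases hm : m ∈ closedPolygon b
  · obtain ⟨j, hmj⟩ := mem_iUnion.1 hm
    obtain ⟨hother, hre, hside⟩ := hP.eventually_mem_iff hmj hv
    have hmA : b j - m ≠ 0 := sub_ne_zero.2 fun h => hv ⟨j, h⟩
    -- near `m` the defect is a continuous function: the argument of the logarithm of the side through
    -- `m` is close to the negative real axis, and replacing it by its opposite adds `± 1 / 2`
    have hc : ContinuousAt (fun q => (2 * Real.pi * Complex.I)⁻¹ *
        (Complex.log (-((b (finRotate n j) - q) / (b j - q))) + ∑ k ∈ Finset.univ.erase j,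
          Complex.log ((b (finRotate n k) - q) / (b k - q))) - 1 / 2) m := by
      refine (continuousAt_const.mul (ContinuousAt.add ?_ ?_)).sub continuousAt_const
      · refine ContinuousAt.clog ?_ (Or.inl (by simpa using hre))
        exact ((continuousAt_const.sub continuousAt_id).div (continuousAt_const.sub continuousAt_id)
          hmA).neg
      · exact tendsto_finsetSum _ fun k hk =>
          continuousAt_log_div (hother k (Finset.ne_of_mem_erase hk))
    refine exists_int_eventually_eq ((hc.tendsto.mono_left nhdsWithin_le_nhds).congr' ?_) hint
    filter_upwards [hside, self_mem_nhdsWithin] with q hq hqΓ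
    have hA : b j - q ≠ 0 := sub_ne_zero.2 fun h => hqΓ (h ▸ vertex_mem_closedPolygon j)
    have hn := Complex.normSq_pos.2 hA
    have hpi : (Real.pi : ℂ) ≠ 0 := by exact_mod_cast Real.pi_ne_zero
    have hI := Complex.I_ne_zero
    rw [defect, windingNumber_eq_sum_log hqΓ, ← Finset.add_sum_erase _ _ (Finset.mem_univ j)]
    rcases hq with ⟨hq, hqP⟩ | ⟨hq, hqP⟩
    · rw [log_of_im_pos (r := (b (finRotate n j) - q) / (b j - q))
        (by rw [im_div_eq_cross]; exact div_pos hq hn), indicator_of_mem hqP, Pi.one_apply]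
      field_simp
      ring
    · rw [log_of_im_neg (r := (b (finRotate n j) - q) / (b j - q))
        (by rw [im_div_eq_cross]; exact div_neg_of_neg_of_pos hq hn), indicator_of_notMem hqP]
      field_simp
      ring
  · have h1 : ∀ᶠ q in 𝓝 m, P.indicator (1 : ℂ → ℂ) q = P.indicator 1 m := by
      have hfr : m ∉ frontier P := hP.frontier_eq ▸ hm
      by_cases hmP : m ∈ P
      · have : P ∈ 𝓝 m := by
          rw [← mem_interior_iff_mem_nhds]
          by_contra hcon
          exact hfr ⟨subset_closure hmP, hcon⟩
        filter_upwards [this] with q hq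
        simp [hq, hmP]
      · filter_upwards [hP.isCompact.isClosed.isOpen_compl.mem_nhds hmP] with q hq
        rw [indicator_of_notMem hq, indicator_of_notMem hmP]
    obtain ⟨k, hk⟩ := exists_int_defect P hm
    refine ⟨k, nhdsWithin_le_nhds ?_⟩
    filter_upwards [h1, eventually_windingNumber_eq hm] with q h2 h3
    rw [← hk, defect, defect, h2, h3]

end IsCCWPolygon

end Curve

section Simple

variable {n : ℕ} {w : Fin n → ℂ} {D : Set (Sym2 (Fin n))} {b : Fin n → ℂ} {P : Set ℂ}

theorem windingNumber_eq_zero (hn : 3 ≤ n) (hw : IsConvexCCW w) (hD : IsTriangulation w D)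
    {q : ℂ} (hq : q ∉ convexHull ℝ (range b)) : windingNumber b q = 0 := by
  rw [windingNumber_eq_sum_triIndex hn hw hD fun i j h =>
    hq (segment_subset_convexHull (mem_range_self i) (mem_range_self j) h)]
  refine Finset.sum_eq_zero fun f _ => ?_
  rw [triIndex, indicator_of_notMem, Complex.ofReal_zero]
  intro h
  exact hq (convexHull_triple_subset (openTriangle_subset_convexHull _ _ _ h))

theorem isCompact_convexHull_range (b : Fin n → ℂ) : IsCompact (convexHull ℝ (range b)) :=
  isCompact_convexPolygon b

/-- The winding number of a simple counterclockwise polygon is the indicator function of the region: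
the difference is locally constant on the connected complement of the vertices, and vanishes far
away. -/
theorem IsCCWPolygon.windingNumber_eq_indicator (hn : 3 ≤ n) (hw : IsConvexCCW w)
    (hD : IsTriangulation w D) (hP : IsCCWPolygon b P) {q : ℂ} (hq : q ∉ closedPolygon b) :
    windingNumber b q = P.indicator 1 q := by
  have hV : IsPreconnected (range b)ᶜ :=
    ((finite_range b).countable.isPathConnected_compl_of_one_lt_rank
      (by rw [Complex.rank_real_complex]; norm_num)).isConnected.isPreconnected
  have hdense : ∀ m, (𝓝[(closedPolygon b)ᶜ] m).NeBot := fun m =>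
    mem_closure_iff_nhdsWithin_neBot.1
      (Measure.dense_of_ae (measure_eq_zero_iff_ae_notMem.1 (volume_closedPolygon b)) m)
  have hopen : ∀ k : ℤ, IsOpen {m | ∀ᶠ q in 𝓝[(closedPolygon b)ᶜ] m, defect b P q = k} :=
    fun k => isOpen_iff_eventually.2 fun m hm => eventually_nhds_nhdsWithin.2 hm
  -- a point far away, where the difference vanishes
  obtain ⟨p, hp⟩ := (ne_univ_iff_exists_notMem _).1
    ((isCompact_convexHull_range b).union hP.isCompact).ne_univ
  have hpV : p ∈ (range b)ᶜ := fun h => hp (Or.inl (subset_convexHull ℝ _ h))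
  have hp0 : ∀ᶠ q in 𝓝[(closedPolygon b)ᶜ] p, defect b P q = (0 : ℤ) := by
    refine nhdsWithin_le_nhds ?_
    filter_upwards [((isCompact_convexHull_range b).union hP.isCompact).isClosed.isOpen_compl.mem_nhds
      hp] with q hq
    rw [defect, windingNumber_eq_zero hn hw hD fun h => hq (Or.inl h),
      indicator_of_notMem fun h => hq (Or.inr h), sub_zero, Int.cast_zero]
  obtain ⟨k, hk⟩ := hP.exists_eventually_defect_eq fun h => by
    obtain ⟨j, rfl⟩ : q ∈ range b := h
    exact hq (vertex_mem_closedPolygon j)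
  have hk0 : k = 0 := by
    by_contra hne
    obtain ⟨m, -, hm0, hm1⟩ := hV _ _ (hopen 0)
      (isOpen_iUnion fun k : {k : ℤ // k ≠ 0} => hopen k)
      (fun m hm => by
        obtain ⟨k, hk⟩ := hP.exists_eventually_defect_eq hm
        by_cases h : k = 0
        · exact Or.inl (h ▸ hk)
        · exact Or.inr (mem_iUnion.2 ⟨⟨k, h⟩, hk⟩))
      ⟨p, hpV, hp0⟩
      ⟨q, fun ⟨j, hj⟩ => hq (hj ▸ vertex_mem_closedPolygon j), mem_iUnion.2 ⟨⟨k, hne⟩, hk⟩⟩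
    obtain ⟨k', hm1⟩ := mem_iUnion.1 hm1
    rw [mem_ofPred_eq] at hm0 hm1
    have := hdense m
    obtain ⟨x, h0, h1⟩ := (hm0.and hm1).exists
    exact k'.2 (by exact_mod_cast h1.symm.trans h0)
  rw [(isClosed_closedPolygon b).isOpen_compl.nhdsWithin_eq hq] at hk
  have h := hk.self_of_nhds
  rw [hk0, Int.cast_zero, defect, sub_eq_zero] at h
  exact h

theorem exists_nhds_polygonalMeasure_real (hn : 3 ≤ n) (hw : IsConvexCCW w)
    (hD : IsTriangulation w D) {q : ℂ} (hq : q ∉ closedPolygon b) :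
    ∃ U ∈ 𝓝 q, ∀ B : Set ℂ, MeasurableSet B → B ⊆ U →
      polygonalMeasure w D (fun j => realPoint (b j)) (realPoint '' B) =
        windingNumber b q * (volume.real B : ℂ) := by
  refine ⟨_, eventually_windingNumber_eq hq, fun B hB hBU => ?_⟩
  rw [polygonalMeasure_real hn hw hD (measurableEmbedding_realPoint.measurableSet_image.2 hB),
    preimage_image_eq _ measurableEmbedding_realPoint.injective,
    setIntegral_congr_fun hB fun x hx => hBU hx, setIntegral_const, Complex.real_smul, mul_comm]

theorem IsCCWPolygon.polygonalMeasure_eq (hn : 3 ≤ n) (hw : IsConvexCCW w)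
    (hD : IsTriangulation w D) (hP : IsCCWPolygon b P) {B : Set (ℂ × ℂ)} (hB : MeasurableSet B) :
    polygonalMeasure w D (fun j => realPoint (b j)) B =
      (volume.real (P ∩ realPoint ⁻¹' B) : ℂ) := by
  have hae : windingNumber b =ᵐ[volume] P.indicator 1 := by
    filter_upwards [measure_eq_zero_iff_ae_notMem.1 (volume_closedPolygon b)] with q hq
    exact hP.windingNumber_eq_indicator hn hw hD hq
  rw [polygonalMeasure_real hn hw hD hB, integral_congr_ae (ae_restrict_of_ae hae),
    setIntegral_indicator hP.isCompact.measurableSet, inter_comm]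
  simp only [Pi.one_apply]
  rw [setIntegral_const, Complex.real_smul, mul_one]

end Simple

end PolygonalMeasure

theorem theorem1 (n : ℕ) (_hn : 3 ≤ n) :
    -- (i) arbitrary vertices in `ℂ²`
    (∀ (a : Fin n → ℂ × ℂ) (h : ℂ × ℂ → ℂ), Differentiable ℂ h →
      (∀ (w : Fin n → ℂ) (D : Set (Sym2 (Fin n))) (w' : Fin n → ℂ) (D' : Set (Sym2 (Fin n))),
        IsConvexCCW w → IsTriangulation w D →
        IsConvexCCW w' → IsTriangulation w' D' →
        ∫ᵛ p, h p ∂[ContinuousLinearMap.mul ℝ ℂ; polygonalMeasure w D a] =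
          ∫ᵛ p, h p ∂[ContinuousLinearMap.mul ℝ ℂ; polygonalMeasure w' D' a]) ∧
      (∀ (w : Fin n → ℂ) (D : Set (Sym2 (Fin n))),
        IsConvexCCW w → IsTriangulation w D →
        (polygonalMeasure w D a).Integrable h ∧
        ∀ ω : ℂ × ℂ → (ℂ × ℂ →L[ℝ] ℂ), ContDiff ℝ 1 ω →
          (∀ p u v : ℂ × ℂ, dForm ω p u v =
            Complex.I / 2 * h p * dzdzbar u v) →
          ∫ᵛ p, h p ∂[ContinuousLinearMap.mul ℝ ℂ; polygonalMeasure w D a] =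
            closedPolygonIntegral a ω)) ∧
    -- (ii) real vertices
    (∀ b : Fin n → ℂ,
      (∀ (w : Fin n → ℂ) (D : Set (Sym2 (Fin n))) (w' : Fin n → ℂ) (D' : Set (Sym2 (Fin n))),
        IsConvexCCW w → IsTriangulation w D →
        IsConvexCCW w' → IsTriangulation w' D' →
        polygonalMeasure w D (fun j => realPoint (b j)) =
          polygonalMeasure w' D' (fun j => realPoint (b j))) ∧
      (∀ (w : Fin n → ℂ) (D : Set (Sym2 (Fin n))),
        IsConvexCCW w → IsTriangulation w D →
        -- the measure is supported on a compact subset of the real plane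
        (∃ K : Set ℂ, IsCompact K ∧ ∀ B : Set (ℂ × ℂ), MeasurableSet B →
          Disjoint B (realPoint '' K) →
          polygonalMeasure w D (fun j => realPoint (b j)) B
            = 0) ∧
        -- its density is the winding number, globally and near every point off the curve
        Integrable (windingNumber b) volume ∧
        (∀ B : Set (ℂ × ℂ), MeasurableSet B →
          polygonalMeasure w D (fun j => realPoint (b j)) B =
            ∫ q in realPoint ⁻¹' B, windingNumber b q) ∧
        (∀ q : ℂ, q ∉ closedPolygon b → ∃ U ∈ 𝓝 q, ∀ B : Set ℂ,
          MeasurableSet B → B ⊆ U →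
          polygonalMeasure w D (fun j => realPoint (b j))
              (realPoint '' B) =
            windingNumber b q * (volume.real B : ℂ)) ∧
        -- a counterclockwise polygon: the measure is its Lebesgue measure
        (∀ P : Set ℂ, IsCCWPolygon b P →
          ∀ B : Set (ℂ × ℂ), MeasurableSet B →
          polygonalMeasure w D (fun j => realPoint (b j)) B =
            (volume.real (P ∩ realPoint ⁻¹' B) : ℂ)))) := by
  refine ⟨fun a h hh => ⟨fun w D w' D' hw hD hw' hD' => ?_, fun w D hw hD =>
    ⟨integrable_polygonalMeasure hw hD hh.continuous, fun ω hω hdω =>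
      integral_eq_closedPolygonIntegral _hn hw hD hh.continuous hω hdω⟩⟩,
    fun b => ⟨fun w D w' D' hw hD hw' hD' => ?_, fun w D hw hD =>
      ⟨⟨_, isCompact_convexHull_range b, fun B hB hd => polygonalMeasure_real_eq_zero hw hD hB hd⟩,
        integrable_windingNumber _hn hw hD, fun B hB => polygonalMeasure_real _hn hw hD hB,
        fun q hq => exists_nhds_polygonalMeasure_real _hn hw hD hq,
        fun P hP B hB => hP.polygonalMeasure_eq _hn hw hD hB⟩⟩⟩
  · obtain ⟨ω, hω, hdω⟩ := exists_primitive hh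
    rw [integral_eq_closedPolygonIntegral _hn hw hD hh.continuous hω hdω,
      integral_eq_closedPolygonIntegral _hn hw' hD' hh.continuous hω hdω]
  · refine VectorMeasure.ext fun B hB => ?_
    rw [polygonalMeasure_real _hn hw hD hB, polygonalMeasure_real _hn hw' hD' hB]
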